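/- Let $((Y_i(1),Y_i(0),X_i))_{i\ge 1}$ be i.i.d. random vectors, where $Y_i(1),Y_i(0)$ are real-valued potential outcomes and the covariates $X_i$ take values in a measurable space $\mathcal X$ (for instance $\mathbf R^k$, or the support of $X_i$), and suppose $E[Y_i(d)^2]<\infty$ for $d\in\{0,1\}$. Let $h:\mathcal X\to\mathbf R$ be a measurable function such that (a) $E[\mathrm{Var}[Y_i(d)\mid h(X_i)]]>0$ for $d\in\{0,1\}$; (b) $E[Y_i(d)^r\mid h(X_i)=z]$ is (has a version that is) Lipschitz in $z$ for $r=1,2$ and $d=0,1$; (c) $E[h(X_i)^2]<\infty$. For each $n$, consider the sample of units $1,\dots,2n$ and write $X^{(n)}=(X_1,\dots,X_{2n})$. Let $\pi=\pi^h$ be a permutation of $\{1,\dots,2n\}$ with $h(X_{\pi(1)})\le\dots\le h(X_{\pi(2n)})$, chosen as a measurable function of $(h(X_1),\dots,h(X_{2n}))$ (ties among these values may be broken in any way that depends on these values only). Given $X^{(n)}$, and conditionally independently of the potential outcomes, the treatment status $D^{(n)}=(D_1,\dots,D_{2n})\in\{0,1\}^{2n}$ is determined as follows: independently across the $n$ pairs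 $\{\pi(2s-1),\pi(2s)\}$, $1\le s\le n$, one unit of the pair, chosen uniformly at random, has $D_i=1$ and the other has $D_i=0$. The observed outcomes are $Y_i=Y_i(1)D_i+Y_i(0)(1-D_i)$. Define, for $d\in\{0,1\}$, $$\hat\mu_n(d)=\frac1n\sum_{1\le i\le 2n:\,D_i=d}Y_i,\qquad \hat\sigma_n^2(d)=\frac1n\sum_{1\le i\le 2n:\,D_i=d}(Y_i-\hat\mu_n(d))^2,$$ $$\hat\rho_n=\frac2n\sum_{1\le j\le\lfloor n/2\rfloor}\bigl(Y_{\pi(4j-3)}+Y_{\pi(4j-2)}\bigr)\bigl(Y_{\pi(4j-1)}+Y_{\pi(4j)}\bigr),$$ $$\hat\varsigma_{h,n}^2=\hat\sigma_n^2(1)+\hat\sigma_n^2(0)-\tfrac12\hat\rho_n+\tfrac12\bigl(\hat\mu_n(1)+\hat\mu_n(0)\bigr)^2,$$ and $$\varsigma_h^2=\mathrm{Var}[Y_i(1)]+\mathrm{Var}[Y_i(0)]-\tfrac12E\Bigl[\bigl(E[Y_i(1)+Y_i(0)\mid h(X_i)]-E[Y_i(1)+Y_i(0)]\bigr)^2\Bigr].$$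 Then $\hat\varsigma_{h,n}^2\to\varsigma_h^2$ in probability as $n\to\infty$. -/

import Mathlib

open MeasureTheory ProbabilityTheory Filter
open scoped Topology

noncomputable section

/-! Units of a sample of size `2 * n` are the elements of `Fin (2 * n)` (numbered from `0`).
Treatment status and treatment arms are elements of `Fin 2`: `1` is treated, `0` is control. -/

/-- A stratification of `2 * n` units: finitely many pairwise disjoint strata that cover all
units. -/
structure Stratification (n : ℕ) where
  /-- the number of strata -/
  S : ℕ
  /-- the strata -/
  stratum : Fin S → Finset (Fin (2 * n))
  disj : ∀ s t, s ≠ t → Disjoint (stratum s) (stratum t)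
  cover : ∀ i, ∃ s, i ∈ stratum s

/-- The stratification into the `n` pairs `{π (2 s), π (2 s + 1)}`, `0 ≤ s < n`. -/
def pairStratification {n : ℕ} (π : Equiv.Perm (Fin (2 * n))) : Stratification n where
  S := n
  stratum s := {π ⟨2 * s, by omega⟩, π ⟨2 * s + 1, by omega⟩}
  disj s t hst := by
    have hne : (s : ℕ) ≠ t := fun h => hst (Fin.ext h)
    simp only [Finset.disjoint_left, Finset.mem_insert, Finset.mem_singleton]
    rintro a (rfl | rfl) h <;>
      simp only [EmbeddingLike.apply_eq_iff_eq, Fin.mk.injEq] at h <;> omega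
  cover i := by
    refine ⟨⟨(π.symm i : ℕ) / 2, by have := (π.symm i).isLt; omega⟩, ?_⟩
    simp only [Finset.mem_insert, Finset.mem_singleton, ← Equiv.symm_apply_eq, Fin.ext_iff]
    omega

/-- The probability of the treatment vector `d` when, independently across the strata of `lam`,
half of the units of each stratum are chosen uniformly at random and treated. -/
def assignProb {n : ℕ} (lam : Stratification n) (d : Fin (2 * n) → Fin 2) : ℝ :=
  ∏ s : Fin lam.S,
    if 2 * ((lam.stratum s).filter fun i => d i = 1).card = (lam.stratum s).card then
      (1 : ℝ) / ((lam.stratum s).card.choose ((lam.stratum s).card / 2))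
    else 0

section Model

variable {Ω 𝒳 : Type*} [MeasurableSpace Ω] [MeasurableSpace 𝒳]

/-- `((Y_i(1), Y_i(0), X_i))_i` is an i.i.d. sequence of random vectors; `Y d i` is the potential
outcome of unit `i` under treatment status `d`, and `X i` are its covariates. -/
structure IsIIDSample (P : Measure Ω) (Y : Fin 2 → ℕ → Ω → ℝ) (X : ℕ → Ω → 𝒳) : Prop where
  measurable_outcome : ∀ d i, Measurable (Y d i)
  measurable_covariate : ∀ i, Measurable (X i)
  indep : iIndepFun (fun i ω => (Y 1 i ω, Y 0 i ω, X i ω)) P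
  ident : ∀ i, IdentDistrib (fun ω => (Y 1 i ω, Y 0 i ω, X i ω))
    (fun ω => (Y 1 0 ω, Y 0 0 ω, X 0 ω)) P P

/-- The treatment vector `D` of the first `2 * n` units is assigned, given the covariates of these
units, by treating a uniformly random half of each stratum of `lam X`, independently across strata
(and, given the covariates, independently of the potential outcomes): its conditional law given
the potential outcomes and the covariates is `assignProb (lam X)`. -/
structure AssignedHalf (P : Measure Ω) (Y : Fin 2 → ℕ → Ω → ℝ) (X : ℕ → Ω → 𝒳) (n : ℕ)
    (lam : (Fin (2 * n) → 𝒳) → Stratification n) (D : Ω → Fin (2 * n) → Fin 2) : Prop where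
  measurable_assignment : Measurable D
  cond_law : ∀ d : Fin (2 * n) → Fin 2,
    P[{ω | D ω = d}.indicator (fun _ => (1 : ℝ)) |
        MeasurableSpace.comap
          (fun ω (i : Fin (2 * n)) => (Y 1 i ω, Y 0 i ω, X i ω)) inferInstance]
      =ᵐ[P] fun ω => assignProb (lam fun i => X i ω) d

/-- The σ-algebra generated by `h (X_0)`. -/
abbrev sigmaH (X : ℕ → Ω → 𝒳) (h : 𝒳 → ℝ) : MeasurableSpace Ω :=
  MeasurableSpace.comap (fun ω => h (X 0 ω)) inferInstance

/-- The class of admissible functions `h`. -/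
structure MemH (P : Measure Ω) (Y : Fin 2 → ℕ → Ω → ℝ) (X : ℕ → Ω → 𝒳) (h : 𝒳 → ℝ) :
    Prop where
  measurable : Measurable h
  /-- `0 < E[Var[Y(d) | h(X)]]` -/
  condVar_pos : ∀ d, 0 < ∫ ω, (condVar (sigmaH X h) (Y d 0) P) ω ∂P
  /-- `E[Y(d)^r | h(X) = z]` has a version that is Lipschitz in `z`, for `r = 1, 2`. -/
  lipschitz : ∀ d, ∀ r ∈ ({1, 2} : Set ℕ), ∃ φ : ℝ → ℝ, (∃ K, LipschitzWith K φ) ∧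
    P[fun ω => Y d 0 ω ^ r | sigmaH X h] =ᵐ[P] fun ω => φ (h (X 0 ω))
  /-- `E[h(X)^2] < ∞` -/
  sq_integrable : MemLp (fun ω => h (X 0 ω)) 2 P

/-- The limiting variance
`Var[Y(1)] + Var[Y(0)] - (1/2) E[(E[Y(1) + Y(0) | h(X)] - E[Y(1) + Y(0)])^2]`. -/
def limitVar (P : Measure Ω) (Y : Fin 2 → ℕ → Ω → ℝ) (X : ℕ → Ω → 𝒳) (h : 𝒳 → ℝ) : ℝ :=
  variance (Y 1 0) P + variance (Y 0 0) P
    - 1 / 2 * ∫ ω, ((P[fun ω' => Y 1 0 ω' + Y 0 0 ω' | sigmaH X h]) ω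
        - ∫ ω', (Y 1 0 ω' + Y 0 0 ω') ∂P) ^ 2 ∂P

end Model

/-- A rule that orders the units by the values `z i = h (X_i)`: for each `n` and each vector `z` of
values, a permutation along which the values are nondecreasing. Ties are broken by an arbitrary
(measurable) function of the vector of values. -/
structure IsSortingRule (σ : ∀ n : ℕ, (Fin (2 * n) → ℝ) → Equiv.Perm (Fin (2 * n))) : Prop where
  sorted : ∀ (n : ℕ) (z : Fin (2 * n) → ℝ), Monotone fun k => z (σ n z k)
  measurable : ∀ (n : ℕ) (π : Equiv.Perm (Fin (2 * n))), MeasurableSet {z | σ n z = π}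

/-! The statistics, as functions of the observed outcomes `y` and treatment status `d`. -/

/-- The mean of the outcomes of the units with treatment status `a`. -/
def muHat (n : ℕ) (y : Fin (2 * n) → ℝ) (d : Fin (2 * n) → Fin 2) (a : Fin 2) : ℝ :=
  (1 / n : ℝ) * ∑ i with d i = a, y i

/-- The variance of the outcomes of the units with treatment status `a`. -/
def sigmaSqHat (n : ℕ) (y : Fin (2 * n) → ℝ) (d : Fin (2 * n) → Fin 2) (a : Fin 2) : ℝ :=
  (1 / n : ℝ) * ∑ i with d i = a, (y i - muHat n y d a) ^ 2

/-- The "pairs of pairs" correction term. -/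
def rhoHat (n : ℕ) (π : Equiv.Perm (Fin (2 * n))) (y : Fin (2 * n) → ℝ) : ℝ :=
  (2 / n : ℝ) * ∑ j : Fin (n / 2),
    (y (π ⟨4 * j, by omega⟩) + y (π ⟨4 * j + 1, by omega⟩)) *
      (y (π ⟨4 * j + 2, by omega⟩) + y (π ⟨4 * j + 3, by omega⟩))

/-- The adjusted variance estimator. -/
def varHat (n : ℕ) (π : Equiv.Perm (Fin (2 * n))) (y : Fin (2 * n) → ℝ)
    (d : Fin (2 * n) → Fin 2) : ℝ :=
  sigmaSqHat n y d 1 + sigmaSqHat n y d 0 - 1 / 2 * rhoHat n π y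
    + 1 / 2 * (muHat n y d 1 + muHat n y d 0) ^ 2

end

section ConvergenceInMeasure

variable {Ω : Type*} [MeasurableSpace Ω] {P : Measure Ω}

/-- Continuous mapping theorem for convergence in measure of two sequences to constants. -/
lemma tendstoInMeasure_const_comp₂ {ι : Type*} {l : Filter ι} {f g : ι → Ω → ℝ} {c d : ℝ}
    {φ : ℝ → ℝ → ℝ} (hf : TendstoInMeasure P f l (fun _ => c))
    (hg : TendstoInMeasure P g l (fun _ => d)) (hφ : Continuous fun p : ℝ × ℝ => φ p.1 p.2) :
    TendstoInMeasure P (fun n ω => φ (f n ω) (g n ω)) l (fun _ => φ c d) := by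
  rw [tendstoInMeasure_iff_dist] at hf hg ⊢
  intro ε hε
  obtain ⟨δ, hδ, h⟩ := Metric.continuousAt_iff.1 (hφ.continuousAt (x := (c, d))) ε hε
  have hsum := (hf δ hδ).add (hg δ hδ)
  rw [add_zero] at hsum
  refine tendsto_of_tendsto_of_tendsto_of_le_of_le tendsto_const_nhds hsum
    (fun _ => zero_le) fun n => (measure_mono fun ω hω => ?_).trans (measure_union_le _ _)
  simp only [Set.mem_ofPred_eq, Set.mem_union] at hω ⊢
  by_contra! hlt
  have h' : dist (f n ω, g n ω) (c, d) < δ := by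
    rw [Prod.dist_eq]
    exact max_lt hlt.1 hlt.2
  exact (h h').not_ge hω

lemma tendstoInMeasure_const_add {ι : Type*} {l : Filter ι} {f g : ι → Ω → ℝ} {c d : ℝ}
    (hf : TendstoInMeasure P f l (fun _ => c)) (hg : TendstoInMeasure P g l (fun _ => d)) :
    TendstoInMeasure P (fun n ω => f n ω + g n ω) l (fun _ => c + d) :=
  tendstoInMeasure_const_comp₂ (φ := fun x y => x + y) hf hg continuous_add

lemma tendstoInMeasure_const_mul {ι : Type*} {l : Filter ι} {f g : ι → Ω → ℝ} {c d : ℝ}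
    (hf : TendstoInMeasure P f l (fun _ => c)) (hg : TendstoInMeasure P g l (fun _ => d)) :
    TendstoInMeasure P (fun n ω => f n ω * g n ω) l (fun _ => c * d) :=
  tendstoInMeasure_const_comp₂ (φ := fun x y => x * y) hf hg continuous_mul

lemma tendstoInMeasure_const_smul {ι : Type*} {l : Filter ι} {f : ι → Ω → ℝ} {c : ℝ} (a : ℝ)
    (hf : TendstoInMeasure P f l (fun _ => c)) :
    TendstoInMeasure P (fun n ω => a * f n ω) l (fun _ => a * c) :=
  tendstoInMeasure_const_comp₂ (φ := fun x _ => a * x) hf hf (by fun_prop)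

/-- A sequence dominated by functions with small integrals tends to zero in measure. -/
lemma tendstoInMeasure_zero_of_dominated [IsFiniteMeasure P] {T : ℕ → Ω → ℝ}
    (h : ∀ δ > 0, ∀ᶠ n in atTop, ∃ Z : Ω → ℝ, Integrable Z P ∧ (∀ ω, |T n ω| ≤ Z ω) ∧
      ∫ ω, Z ω ∂P ≤ δ) :
    TendstoInMeasure P T atTop (fun _ => 0) := by
  rw [tendstoInMeasure_iff_measureReal_norm]
  intro ε hε
  rw [Metric.tendsto_nhds]
  intro η hη
  filter_upwards [h (ε * η / 2) (by positivity)] with n ⟨Z, hZ, hTZ, hint⟩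
  have hmarkov := mul_meas_ge_le_integral_of_nonneg
    (ae_of_all _ fun ω => (abs_nonneg _).trans (hTZ ω)) hZ ε
  have hmono : P.real {ω | ε ≤ ‖T n ω - 0‖} ≤ P.real {ω | ε ≤ Z ω} := by
    refine measureReal_mono fun ω hω => ?_
    simp only [Set.mem_ofPred_eq, sub_zero, Real.norm_eq_abs] at hω ⊢
    exact hω.trans (hTZ ω)
  rw [Real.dist_eq, sub_zero, abs_of_nonneg measureReal_nonneg]
  have : ε * P.real {ω | ε ≤ Z ω} < ε * η := by nlinarith
  exact hmono.trans_lt (lt_of_mul_lt_mul_left this hε.le)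

/-- A sequence tends to zero in measure if, up to an arbitrarily small error in mean, its second
moments are `O(1 / n)`. -/
lemma tendstoInMeasure_zero_of_approx [IsProbabilityMeasure P] {T : ℕ → Ω → ℝ}
    (h : ∀ δ > 0, ∃ (A B : ℕ → Ω → ℝ) (C : ℝ), ∀ n, 0 < n →
      (∀ ω, |T n ω| ≤ |A n ω| + B n ω) ∧ Integrable (fun ω => A n ω ^ 2) P ∧
      Integrable (B n) P ∧ ∫ ω, A n ω ^ 2 ∂P ≤ C / n ∧ ∫ ω, B n ω ∂P ≤ δ) :
    TendstoInMeasure P T atTop (fun _ => 0) := by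
  refine tendstoInMeasure_zero_of_dominated fun δ hδ => ?_
  set η := δ / 3 with hη
  have hη0 : 0 < η := by positivity
  obtain ⟨A, B, C, hAB⟩ := h η hη0
  have hlim : Tendsto (fun n : ℕ => C / n / η) atTop (𝓝 0) := by
    simpa using (tendsto_const_div_atTop_nhds_zero_nat C).div_const η
  filter_upwards [eventually_gt_atTop 0, hlim.eventually (gt_mem_nhds hη0)] with n hn hnC
  obtain ⟨hT, hA, hB, hA', hB'⟩ := hAB n hn
  refine ⟨fun ω => (η + A n ω ^ 2 / η) + B n ω, ?_, fun ω => ?_, ?_⟩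
  · exact ((integrable_const η).add (hA.div_const η)).add hB
  · refine (hT ω).trans (add_le_add_left ?_ _)
    have h1 : |A n ω| * η ≤ η * η + A n ω ^ 2 := by
      rw [← sq_abs (A n ω)]
      nlinarith [sq_nonneg (|A n ω| - η), abs_nonneg (A n ω), sq_nonneg (|A n ω| + η)]
    calc |A n ω| = |A n ω| * η / η := by field_simp
      _ ≤ (η * η + A n ω ^ 2) / η := by gcongr
      _ = _ := by field_simp
  · have hA1 : Integrable (fun ω => η + A n ω ^ 2 / η) P :=
      (integrable_const η).add (hA.div_const η)
    rw [integral_add hA1 hB, integral_add (integrable_const η) (hA.div_const η),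
      integral_div η (fun ω => A n ω ^ 2)]
    simp only [integral_const, probReal_univ, smul_eq_mul, one_mul]
    have : (∫ ω, A n ω ^ 2 ∂P) / η ≤ C / n / η := by gcongr
    linarith

/-- The tails of an integrable function have small integrals. -/
lemma exists_integral_tail_le {V : Ω → ℝ} (hV : Integrable V P) (hm : Measurable V) {δ : ℝ}
    (hδ : 0 < δ) : ∃ M : ℝ, 0 ≤ M ∧ ∫ ω, {ω | M < V ω}.indicator V ω ∂P ≤ δ := by
  have hset : ∀ n : ℕ, MeasurableSet {ω | (n : ℝ) < V ω} :=
    fun n => measurableSet_lt measurable_const hm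
  have hanti : Antitone fun n : ℕ => {ω | (n : ℝ) < V ω} := by
    intro m n hmn ω hω
    have : (m : ℝ) ≤ n := by exact_mod_cast hmn
    exact this.trans_lt hω
  have hlim := hanti.tendsto_setIntegral hset hV.integrableOn
  have hempty : ⋂ n : ℕ, {ω | (n : ℝ) < V ω} = ∅ := by
    ext ω
    obtain ⟨n, hn⟩ := exists_nat_ge (V ω)
    simp only [Set.mem_iInter, Set.mem_ofPred_eq, Set.mem_empty_iff_false, iff_false, not_forall,
      not_lt]
    exact ⟨n, hn⟩
  rw [hempty, Measure.restrict_empty, integral_zero_measure] at hlim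
  obtain ⟨n, hn⟩ := (hlim.eventually (gt_mem_nhds hδ)).exists
  exact ⟨n, n.cast_nonneg, by rw [integral_indicator (hset n)]; exact hn.le⟩

end ConvergenceInMeasure

section Resampling

variable {𝒲 : Type*} [MeasurableSpace 𝒲] (μ : Measure 𝒲) [IsProbabilityMeasure μ]
  {ι : Type*} [Fintype ι] [DecidableEq ι]

/-- Replacing one coordinate by an independent copy preserves a product measure. -/
lemma measurePreserving_pi_update (i : ι) :
    MeasurePreserving (fun p : (ι → 𝒲) × 𝒲 => Function.update p.1 i p.2)
      ((Measure.pi fun _ => μ).prod μ) (Measure.pi fun _ => μ) := by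
  have hmeas : Measurable fun p : (ι → 𝒲) × 𝒲 => Function.update p.1 i p.2 := by
    rw [measurable_pi_iff]
    intro j
    by_cases hj : j = i
    · subst hj; simpa using measurable_snd
    · simp only [Function.update_of_ne hj]
      fun_prop
  refine ⟨hmeas, (Measure.pi_eq fun s hs => ?_).symm⟩
  rw [Measure.map_apply hmeas (MeasurableSet.univ_pi hs)]
  have hpre : (fun p : (ι → 𝒲) × 𝒲 => Function.update p.1 i p.2) ⁻¹' Set.univ.pi s
      = (Set.univ.pi (Function.update s i Set.univ)) ×ˢ s i := by
    ext ⟨w, x⟩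
    simp only [Set.mem_preimage, Set.mem_pi, Set.mem_univ, true_implies, Set.mem_prod]
    constructor
    · intro h
      refine ⟨fun j => ?_, by simpa using h i⟩
      by_cases hj : j = i
      · subst hj; simp
      · simpa [Function.update_of_ne hj] using h j
    · rintro ⟨h, hx⟩ j
      by_cases hj : j = i
      · subst hj; simpa using hx
      · simpa [Function.update_of_ne hj] using h j
  rw [hpre, Measure.prod_prod, Measure.pi_pi, ← Finset.mul_prod_erase _ _ (Finset.mem_univ i),
    ← Finset.mul_prod_erase Finset.univ (fun j => μ (s j)) (Finset.mem_univ i), mul_comm]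
  simp only [Function.update_self, measure_univ, one_mul]
  congr 1
  refine Finset.prod_congr rfl fun j hj => ?_
  rw [Function.update_of_ne (Finset.ne_of_mem_erase hj)]

/-- An integral over a product space vanishes if all integrals over one coordinate do. -/
lemma integral_pi_eq_zero_of_update (i : ι) {F : (ι → 𝒲) → ℝ}
    (hF : Integrable F (Measure.pi fun _ => μ))
    (h : ∀ w, ∫ x, F (Function.update w i x) ∂μ = 0) :
    ∫ w, F w ∂(Measure.pi fun _ => μ) = 0 := by
  have hmp := measurePreserving_pi_update (ι := ι) μ i
  have hint : Integrable (fun p : (ι → 𝒲) × 𝒲 => F (Function.update p.1 i p.2))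
      ((Measure.pi fun _ => μ).prod μ) := hmp.integrable_comp_of_integrable hF
  rw [← hmp.map_eq, integral_map hmp.measurable.aemeasurable
    (by rw [hmp.map_eq]; exact hF.aestronglyMeasurable), integral_prod _ hint]
  simp [h]

/-- If `∫_{ζ ∈ B} ρ = 0` for all `B`, then `ρ (w i)` is orthogonal to functions of the scores
`ζ (w j)`, `j ∈ ι`, and of the coordinates other than the `i`-th. -/
lemma integral_pi_mul_eq_zero (i : ι) {ζ : 𝒲 → ℝ} (hζ : Measurable ζ) {ρ : 𝒲 → ℝ}
    (hρ : ∀ B, MeasurableSet B → ∫ x in ζ ⁻¹' B, ρ x ∂μ = 0)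
    {A : Set (ι → ℝ)} (hA : MeasurableSet A) {G : (ι → 𝒲) → ℝ}
    (hG : ∀ w x, G (Function.update w i x) = G w)
    (hint : Integrable (fun w => ρ (w i) * G w) (Measure.pi fun _ => μ)) :
    ∫ w, A.indicator 1 (fun j => ζ (w j)) * (ρ (w i) * G w) ∂(Measure.pi fun _ => μ) = 0 := by
  have hmA : MeasurableSet {w : ι → 𝒲 | (fun j => ζ (w j)) ∈ A} := by
    have : Measurable fun w : ι → 𝒲 => fun j => ζ (w j) := by fun_prop
    exact this hA
  have hrw : (fun w : ι → 𝒲 => A.indicator (1 : (ι → ℝ) → ℝ) (fun j => ζ (w j))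
      * (ρ (w i) * G w)) = {w : ι → 𝒲 | (fun j => ζ (w j)) ∈ A}.indicator
        (fun w => ρ (w i) * G w) := by
    ext w
    by_cases hw : (fun j => ζ (w j)) ∈ A
    · rw [Set.indicator_of_mem hw, Set.indicator_of_mem (by exact hw)]; simp
    · rw [Set.indicator_of_notMem hw, Set.indicator_of_notMem (by exact hw)]; simp
  refine integral_pi_eq_zero_of_update μ i (hrw ▸ hint.indicator hmA) fun w => ?_
  set B : Set ℝ := {z | Function.update (fun j => ζ (w j)) i z ∈ A} with hB
  have hBm : MeasurableSet B := (measurable_update _) hA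
  have hfun : ∀ x, A.indicator (1 : (ι → ℝ) → ℝ) (fun j => ζ (Function.update w i x j))
      * (ρ (Function.update w i x i) * G (Function.update w i x))
      = (ζ ⁻¹' B).indicator ρ x * G w := by
    intro x
    have hupd : (fun j => ζ (Function.update w i x j))
        = Function.update (fun j => ζ (w j)) i (ζ x) := by
      ext j
      by_cases hj : j = i
      · subst hj; simp
      · simp [Function.update_of_ne hj]
    rw [hupd, hG, Function.update_self, ← mul_assoc]
    congr 1
    by_cases hx : ζ x ∈ B
    · rw [Set.indicator_of_mem (by exact hx), Set.indicator_of_mem (by exact hx)]; simp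
    · rw [Set.indicator_of_notMem (by exact hx), Set.indicator_of_notMem (by exact hx)]; simp
  simp_rw [hfun]
  rw [integral_mul_const, integral_indicator (hζ hBm), hρ B hBm, zero_mul]

end Resampling

section Assignment

/-- Exchange the treatment statuses on the pair that contains the `k`-th unit along `π`. -/
def flipPair {n : ℕ} (π : Equiv.Perm (Fin (2 * n))) (k : Fin (2 * n)) (d : Fin (2 * n) → Fin 2) :
    Fin (2 * n) → Fin 2 :=
  fun i => if (π.symm i : ℕ) / 2 = (k : ℕ) / 2 then (d i).rev else d i

variable {n : ℕ} (π : Equiv.Perm (Fin (2 * n))) (k : Fin (2 * n)) (d : Fin (2 * n) → Fin 2)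

lemma flipPair_involutive : Function.Involutive (flipPair π k) := by
  intro d
  ext i
  by_cases h : (π.symm i : ℕ) / 2 = (k : ℕ) / 2 <;> simp [flipPair, h]

lemma flipPair_self : flipPair π k d (π k) = (d (π k)).rev := by simp [flipPair]

lemma flipPair_of_ne {l : Fin (2 * n)} (hl : (l : ℕ) / 2 ≠ (k : ℕ) / 2) :
    flipPair π k d (π l) = d (π l) := by simp [flipPair, hl]

lemma assignProb_flipPair :
    assignProb (pairStratification π) (flipPair π k d) = assignProb (pairStratification π) d := by
  unfold assignProb
  refine Finset.prod_congr rfl fun s _ => ?_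
  have hs : (s : ℕ) < n := s.isLt
  set a : Fin (2 * n) := π ⟨2 * s, by omega⟩ with ha
  set b : Fin (2 * n) := π ⟨2 * s + 1, by omega⟩ with hb
  have hab : a ≠ b := by simp [ha, hb]
  have hcard : ∀ e : Fin (2 * n) → Fin 2,
      (((pairStratification π).stratum s).filter fun i => e i = 1).card
        = (if e a = 1 then 1 else 0) + (if e b = 1 then 1 else 0) := by
    intro e
    change ((({a, b} : Finset (Fin (2 * n)))).filter fun i => e i = 1).card = _
    rw [Finset.card_filter, Finset.sum_pair hab]
  have hcard' : ((pairStratification π).stratum s).card = 2 := Finset.card_pair hab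
  have hiff : 2 * (((pairStratification π).stratum s).filter fun i => flipPair π k d i = 1).card
        = ((pairStratification π).stratum s).card ↔
      2 * (((pairStratification π).stratum s).filter fun i => d i = 1).card
        = ((pairStratification π).stratum s).card := by
    rw [hcard, hcard, hcard']
    have hfa : flipPair π k d a = if (s : ℕ) = (k : ℕ) / 2 then (d a).rev else d a := by
      simp [flipPair, ha]
    have hfb : flipPair π k d b = if (s : ℕ) = (k : ℕ) / 2 then (d b).rev else d b := by
      have : (2 * (s : ℕ) + 1) / 2 = s := by omega
      simp [flipPair, hb, this]
    rw [hfa, hfb]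
    clear hfa hfb hcard hcard'
    generalize d a = x
    generalize d b = y
    by_cases hk : (s : ℕ) = (k : ℕ) / 2
    · simp only [if_pos hk]
      revert x y
      decide
    · simp only [if_neg hk]
  simp only [hiff]

end Assignment

section Sample

variable {Ω 𝒳 : Type*} [MeasurableSpace Ω] [MeasurableSpace 𝒳]

/-- The vectors `(Y_i(1), Y_i(0), X_i)` of the first `2 * n` units. -/
def sampleVec (Y : Fin 2 → ℕ → Ω → ℝ) (X : ℕ → Ω → 𝒳) (n : ℕ) (ω : Ω) :
    Fin (2 * n) → ℝ × ℝ × 𝒳 :=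
  fun i => (Y 1 i ω, Y 0 i ω, X i ω)

/-- The common law of the vectors `(Y_i(1), Y_i(0), X_i)`. -/
noncomputable def unitLaw (P : Measure Ω) (Y : Fin 2 → ℕ → Ω → ℝ) (X : ℕ → Ω → 𝒳) :
    Measure (ℝ × ℝ × 𝒳) :=
  P.map fun ω => (Y 1 0 ω, Y 0 0 ω, X 0 ω)

variable {P : Measure Ω} {Y : Fin 2 → ℕ → Ω → ℝ} {X : ℕ → Ω → 𝒳}

lemma IsIIDSample.measurable_unit (hiid : IsIIDSample P Y X) (i : ℕ) :
    Measurable fun ω => (Y 1 i ω, Y 0 i ω, X i ω) :=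
  (hiid.measurable_outcome 1 i).prodMk
    ((hiid.measurable_outcome 0 i).prodMk (hiid.measurable_covariate i))

lemma IsIIDSample.measurable_sampleVec (hiid : IsIIDSample P Y X) (n : ℕ) :
    Measurable (sampleVec Y X n) :=
  measurable_pi_lambda _ fun i => hiid.measurable_unit i

lemma IsIIDSample.isProbabilityMeasure_unitLaw [IsProbabilityMeasure P]
    (hiid : IsIIDSample P Y X) : IsProbabilityMeasure (unitLaw P Y X) :=
  Measure.isProbabilityMeasure_map (hiid.measurable_unit 0).aemeasurable

lemma IsIIDSample.map_unit (hiid : IsIIDSample P Y X) (i : ℕ) :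
    P.map (fun ω => (Y 1 i ω, Y 0 i ω, X i ω)) = unitLaw P Y X :=
  (hiid.ident i).map_eq

lemma IsIIDSample.map_sampleVec [IsProbabilityMeasure P] (hiid : IsIIDSample P Y X) (n : ℕ) :
    P.map (sampleVec Y X n) = Measure.pi fun _ => unitLaw P Y X := by
  have h := hiid.indep.precomp (g := fun i : Fin (2 * n) => (i : ℕ)) Fin.val_injective
  have h' := (iIndepFun_iff_map_fun_eq_pi_map
    fun i : Fin (2 * n) => (hiid.measurable_unit i).aemeasurable).1 h
  exact h'.trans (by simp only [hiid.map_unit])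

lemma IsIIDSample.integrable_comp_unit (hiid : IsIIDSample P Y X) {V : ℝ × ℝ × 𝒳 → ℝ}
    (hV : Integrable V (unitLaw P Y X)) (i : ℕ) :
    Integrable (fun ω => V (Y 1 i ω, Y 0 i ω, X i ω)) P := by
  rw [← hiid.map_unit i] at hV
  exact hV.comp_measurable (hiid.measurable_unit i)

lemma IsIIDSample.integral_comp_unit (hiid : IsIIDSample P Y X) {V : ℝ × ℝ × 𝒳 → ℝ}
    (hV : Measurable V) (i : ℕ) :
    ∫ ω, V (Y 1 i ω, Y 0 i ω, X i ω) ∂P = ∫ x, V x ∂(unitLaw P Y X) := by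
  rw [← hiid.map_unit i, integral_map (hiid.measurable_unit i).aemeasurable
    hV.aestronglyMeasurable]

lemma IsIIDSample.memLp_comp_unit (hiid : IsIIDSample P Y X) {V : ℝ × ℝ × 𝒳 → ℝ}
    (hV : MemLp V 2 (unitLaw P Y X)) (i : ℕ) :
    MemLp (fun ω => V (Y 1 i ω, Y 0 i ω, X i ω)) 2 P := by
  rw [← hiid.map_unit i] at hV
  exact hV.comp_of_map (hiid.measurable_unit i).aemeasurable

/-- Integrating out the treatment assignment. -/
lemma AssignedHalf.integral_eq_sum [IsProbabilityMeasure P] (hiid : IsIIDSample P Y X) {n : ℕ}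
    {lam : (Fin (2 * n) → 𝒳) → Stratification n} {D : Ω → Fin (2 * n) → Fin 2}
    (hD : AssignedHalf P Y X n lam D)
    {Φ : (Fin (2 * n) → ℝ × ℝ × 𝒳) → (Fin (2 * n) → Fin 2) → ℝ}
    (hm : ∀ d, Measurable fun w => Φ w d)
    (hint : ∀ d, Integrable (fun ω => Φ (sampleVec Y X n ω) d) P) :
    ∫ ω, Φ (sampleVec Y X n ω) (D ω) ∂P
      = ∑ d, ∫ ω, assignProb (lam fun i => X i ω) d * Φ (sampleVec Y X n ω) d ∂P := by
  have hset : ∀ d, MeasurableSet {ω | D ω = d} :=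
    fun d => hD.measurable_assignment (measurableSet_singleton d)
  have hsplit : ∀ ω, Φ (sampleVec Y X n ω) (D ω)
      = ∑ d, {ω | D ω = d}.indicator (fun ω => Φ (sampleVec Y X n ω) d) ω := by
    intro ω
    rw [Finset.sum_eq_single (D ω)]
    · simp
    · intro d _ hd
      exact Set.indicator_of_notMem (by simpa using hd.symm) _
    · simp
  simp_rw [hsplit]
  rw [integral_finsetSum _ fun d _ => (hint d).indicator (hset d)]
  refine Finset.sum_congr rfl fun d _ => ?_
  have hle : MeasurableSpace.comap (sampleVec Y X n) inferInstance ≤ ‹MeasurableSpace Ω› :=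
    (hiid.measurable_sampleVec n).comap_le
  have hprod : {ω | D ω = d}.indicator (fun ω => Φ (sampleVec Y X n ω) d)
      = ({ω | D ω = d}.indicator fun _ => (1 : ℝ)) * fun ω => Φ (sampleVec Y X n ω) d := by
    ext ω
    by_cases hω : ω ∈ {ω | D ω = d} <;> simp [hω]
  have hsm : StronglyMeasurable[MeasurableSpace.comap (sampleVec Y X n) inferInstance]
      fun ω => Φ (sampleVec Y X n ω) d :=
    ((hm d).comp (comap_measurable (sampleVec Y X n))).stronglyMeasurable
  have hint1 : Integrable ({ω | D ω = d}.indicator fun _ => (1 : ℝ)) P :=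
    (integrable_const _).indicator (hset d)
  have hpull := condExp_mul_of_stronglyMeasurable_right hsm
    (hprod ▸ (hint d).indicator (hset d)) hint1
  rw [hprod, ← integral_condExp hle]
  refine integral_congr_ae ?_
  filter_upwards [hpull, hD.cond_law d] with ω h1 h2
  rw [h1, Pi.mul_apply]
  exact congrArg (· * Φ (sampleVec Y X n ω) d) h2

/-- A function of the `k`-th unit along the sorting permutation whose average over the two
treatment statuses is centered given the score is orthogonal to functions of the scores, of the
other units, and of the assignment in the other pairs. -/
lemma integral_centered_mul_eq_zero [IsProbabilityMeasure P] (hiid : IsIIDSample P Y X)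
    {h : 𝒳 → ℝ} (hh : Measurable h)
    {σ : ∀ n : ℕ, (Fin (2 * n) → ℝ) → Equiv.Perm (Fin (2 * n))} (hσ : IsSortingRule σ) {n : ℕ}
    {D : Ω → Fin (2 * n) → Fin 2}
    (hD : AssignedHalf P Y X n (fun x => pairStratification (σ n fun i => h (x i))) D)
    (π : Equiv.Perm (Fin (2 * n))) (k : Fin (2 * n)) {r : ℝ × ℝ × 𝒳 → Fin 2 → ℝ}
    (hr : ∀ a, Measurable fun x => r x a)
    (hr0 : ∀ B, MeasurableSet B →
      ∫ x in (fun x : ℝ × ℝ × 𝒳 => h x.2.2) ⁻¹' B, (r x 0 + r x 1) ∂(unitLaw P Y X) = 0)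
    {G : (Fin (2 * n) → ℝ × ℝ × 𝒳) → (Fin (2 * n) → Fin 2) → ℝ}
    (hG : ∀ d, Measurable fun w => G w d)
    (hGw : ∀ w x d, G (Function.update w (π k) x) d = G w d)
    (hGd : ∀ w d, G w (flipPair π k d) = G w d)
    (hint : ∀ a d, Integrable
      (fun ω => r (sampleVec Y X n ω (π k)) a * G (sampleVec Y X n ω) d) P) :
    ∫ ω, {z | σ n z = π}.indicator (1 : (Fin (2 * n) → ℝ) → ℝ) (fun i => h (X i ω)) *
      (r (sampleVec Y X n ω (π k)) (D ω (π k)) * G (sampleVec Y X n ω) (D ω)) ∂P = 0 := by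
  have := hiid.isProbabilityMeasure_unitLaw
  have hA := hσ.measurable n π
  have hζ : Measurable fun x : ℝ × ℝ × 𝒳 => h x.2.2 := by fun_prop
  have hH : Measurable fun w : Fin (2 * n) → ℝ × ℝ × 𝒳 => fun i => h (w i).2.2 := by fun_prop
  set I : (Fin (2 * n) → ℝ × ℝ × 𝒳) → ℝ :=
    fun w => {z | σ n z = π}.indicator (1 : (Fin (2 * n) → ℝ) → ℝ) (fun i => h (w i).2.2) with hI
  have hIm : Measurable I := (measurable_one.indicator hA).comp hH
  have hI1 : ∀ w, ‖I w‖ ≤ 1 := by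
    intro w
    simp only [hI, Set.indicator]
    split_ifs <;> simp
  have hintI : ∀ a d, Integrable (fun ω => I (sampleVec Y X n ω) *
      (r (sampleVec Y X n ω (π k)) a * G (sampleVec Y X n ω) d)) P := fun a d =>
    (hint a d).bdd_mul (hIm.comp (hiid.measurable_sampleVec n)).aestronglyMeasurable
      (ae_of_all _ fun ω => hI1 _)
  have hmain := hD.integral_eq_sum hiid
    (Φ := fun w d => I w * (r (w (π k)) (d (π k)) * G w d))
    (fun d => hIm.mul (((hr _).comp (measurable_pi_apply _)).mul (hG d)))
    (fun d => hintI _ d)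
  refine hmain.trans ?_
  set p := assignProb (pairStratification π) with hp
  have hpI : ∀ d ω, assignProb (pairStratification (σ n fun i => h (X i ω))) d *
      (I (sampleVec Y X n ω) *
        (r (sampleVec Y X n ω (π k)) (d (π k)) * G (sampleVec Y X n ω) d))
      = p d * (I (sampleVec Y X n ω) *
        (r (sampleVec Y X n ω (π k)) (d (π k)) * G (sampleVec Y X n ω) d)) := by
    intro d ω
    by_cases hω : σ n (fun i => h (X i ω)) = π
    · rw [hω]
    · have : I (sampleVec Y X n ω) = 0 := Set.indicator_of_notMem
        (show (fun i : Fin (2 * n) => h (X i ω)) ∉ {z | σ n z = π} from hω) _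
      rw [this]; ring
  simp_rw [hpI, integral_const_mul]
  have hflip : ∑ d, p d * ∫ ω, I (sampleVec Y X n ω) *
        (r (sampleVec Y X n ω (π k)) (d (π k)) * G (sampleVec Y X n ω) d) ∂P
      = ∑ d, p d * ∫ ω, I (sampleVec Y X n ω) *
        (r (sampleVec Y X n ω (π k)) (d (π k)).rev * G (sampleVec Y X n ω) d) ∂P := by
    rw [← Equiv.sum_comp (flipPair_involutive π k).toPerm]
    refine Finset.sum_congr rfl fun d _ => ?_
    simp only [Function.Involutive.coe_toPerm, hp, assignProb_flipPair, flipPair_self, hGd]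
  have hzero : ∑ d, p d * ∫ ω, I (sampleVec Y X n ω) *
        (r (sampleVec Y X n ω (π k)) (d (π k)) * G (sampleVec Y X n ω) d) ∂P
      + ∑ d, p d * ∫ ω, I (sampleVec Y X n ω) *
        (r (sampleVec Y X n ω (π k)) (d (π k)).rev * G (sampleVec Y X n ω) d) ∂P = 0 := by
    rw [← Finset.sum_add_distrib]
    refine Finset.sum_eq_zero fun d _ => ?_
    rw [← mul_add, ← integral_add (hintI _ d) (hintI _ d)]
    refine mul_eq_zero_of_right _ ?_
    have hsum : ∀ x, r x (d (π k)) + r x (d (π k)).rev = r x 0 + r x 1 := by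
      intro x
      generalize d (π k) = a
      fin_cases a
      · rfl
      · exact add_comm _ _
    have hρint : Integrable (fun ω => (r (sampleVec Y X n ω (π k)) 0
        + r (sampleVec Y X n ω (π k)) 1) * G (sampleVec Y X n ω) d) P := by
      simp_rw [add_mul]
      exact (hint 0 d).add (hint 1 d)
    have hρm : Measurable fun w : Fin (2 * n) → ℝ × ℝ × 𝒳 =>
        (r (w (π k)) 0 + r (w (π k)) 1) * G w d :=
      (((hr 0).comp (measurable_pi_apply _)).add ((hr 1).comp (measurable_pi_apply _))).mul (hG d)
    have hz := integral_pi_mul_eq_zero (unitLaw P Y X) (π k) hζ hr0 hA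
      (G := fun w => G w d) (fun w x => hGw w x d)
      (by
        rw [← hiid.map_sampleVec n]
        exact (integrable_map_measure hρm.aestronglyMeasurable
          (hiid.measurable_sampleVec n).aemeasurable).2 hρint)
    change ∫ w, I w * ((r (w (π k)) 0 + r (w (π k)) 1) * G w d) ∂_ = 0 at hz
    have hIρ : Measurable fun w => I w * ((r (w (π k)) 0 + r (w (π k)) 1) * G w d) := hIm.mul hρm
    rw [← hiid.map_sampleVec n, integral_map (hiid.measurable_sampleVec n).aemeasurable
      hIρ.aestronglyMeasurable] at hz
    rw [← hz]
    refine integral_congr_ae (ae_of_all _ fun ω => ?_)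
    simp only [← hsum, hI]
    ring
  linarith

end Sample

section SecondMoment

/-- Summing nonnegative numbers along an injective reindexing does not increase the sum. -/
lemma sum_comp_le_sum_of_injective {J I : Type*} [Fintype J] [Fintype I] {e : J → I}
    (he : Function.Injective e) {f : I → ℝ} (hf : ∀ i, 0 ≤ f i) : ∑ j, f (e j) ≤ ∑ i, f i :=
  (Finset.sum_map Finset.univ ⟨e, he⟩ f).symm.le.trans (Finset.sum_le_univ_sum_of_nonneg hf)

lemma measurable_comp_of_finite {Ω K : Type*} [MeasurableSpace Ω] [Finite K] {κ : Ω → K}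
    (hκ : ∀ k, MeasurableSet {ω | κ ω = k}) {Ψ : K → Ω → ℝ} (hΨ : ∀ k, Measurable (Ψ k)) :
    Measurable fun ω => Ψ (κ ω) ω := by
  let _ : MeasurableSpace K := ⊤
  have hκm : Measurable κ := measurable_to_countable' hκ
  have hΨm : Measurable fun p : K × Ω => Ψ p.1 p.2 := measurable_from_prod_countable_right hΨ
  exact hΨm.comp (hκm.prodMk measurable_id)

variable {Ω 𝒳 : Type*} [MeasurableSpace Ω] [MeasurableSpace 𝒳]

/-- The permutation that sorts the first `2 * n` units by their scores. -/
def sortPerm (σ : ∀ n : ℕ, (Fin (2 * n) → ℝ) → Equiv.Perm (Fin (2 * n))) (h : 𝒳 → ℝ)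
    (X : ℕ → Ω → 𝒳) (n : ℕ) (ω : Ω) : Equiv.Perm (Fin (2 * n)) :=
  σ n fun i => h (X i ω)

variable {P : Measure Ω} {Y : Fin 2 → ℕ → Ω → ℝ} {X : ℕ → Ω → 𝒳} {h : 𝒳 → ℝ}
  {σ : ∀ n : ℕ, (Fin (2 * n) → ℝ) → Equiv.Perm (Fin (2 * n))}

lemma IsSortingRule.measurableSet_sortPerm (hσ : IsSortingRule σ) (hiid : IsIIDSample P Y X)
    (hh : Measurable h) (n : ℕ) (π : Equiv.Perm (Fin (2 * n))) :
    MeasurableSet {ω | sortPerm σ h X n ω = π} := by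
  have hH : Measurable fun ω => fun i : Fin (2 * n) => h (X i ω) :=
    measurable_pi_lambda _ fun i => hh.comp (hiid.measurable_covariate i)
  exact hH (hσ.measurable n π)

lemma IsIIDSample.integrable_sum_unit (hiid : IsIIDSample P Y X) {V : ℝ × ℝ × 𝒳 → ℝ}
    (hV : Integrable V (unitLaw P Y X)) (n : ℕ) :
    Integrable (fun ω => ∑ i, V (sampleVec Y X n ω i)) P :=
  integrable_finsetSum _ fun i _ => hiid.integrable_comp_unit hV i

lemma IsIIDSample.integral_sum_unit (hiid : IsIIDSample P Y X) {V : ℝ × ℝ × 𝒳 → ℝ}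
    (hm : Measurable V) (hV : Integrable V (unitLaw P Y X)) (n : ℕ) :
    ∫ ω, ∑ i, V (sampleVec Y X n ω i) ∂P = 2 * n * ∫ x, V x ∂(unitLaw P Y X) := by
  rw [integral_finsetSum (f := fun (i : Fin (2 * n)) ω => V (sampleVec Y X n ω i)) _
    fun i _ => hiid.integrable_comp_unit hV i]
  have : ∀ i : Fin (2 * n), ∫ ω, V (sampleVec Y X n ω i) ∂P = ∫ x, V x ∂(unitLaw P Y X) :=
    fun i => hiid.integral_comp_unit hm i
  simp [this]

/-- Second moment bound for sums of orthogonal terms along the sorting permutation. -/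
lemma integral_sq_sum_le [IsProbabilityMeasure P] (hiid : IsIIDSample P Y X)
    (hh : Measurable h) (hσ : IsSortingRule σ) {n : ℕ} {D : Ω → Fin (2 * n) → Fin 2}
    (hD : AssignedHalf P Y X n (fun x => pairStratification (σ n fun i => h (x i))) D)
    {J : Type*} [Fintype J] {k : J → Fin (2 * n)}
    (hk : ∀ j j', j ≠ j' → (k j : ℕ) / 2 ≠ (k j' : ℕ) / 2)
    {r : ℝ × ℝ × 𝒳 → Fin 2 → ℝ} (hr : ∀ a, Measurable fun x => r x a)
    (hr2 : ∀ a, MemLp (fun x => r x a) 2 (unitLaw P Y X))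
    (hr0 : ∀ B, MeasurableSet B →
      ∫ x in (fun x : ℝ × ℝ × 𝒳 => h x.2.2) ⁻¹' B, (r x 0 + r x 1) ∂(unitLaw P Y X) = 0)
    {G : J → Equiv.Perm (Fin (2 * n)) → (Fin (2 * n) → ℝ × ℝ × 𝒳) → (Fin (2 * n) → Fin 2) → ℝ}
    (hG : ∀ j π d, Measurable fun w => G j π w d) {C : ℝ} (hGC : ∀ j π w d, |G j π w d| ≤ C)
    (hGw : ∀ j j' π w x d, G j' π (Function.update w (π (k j)) x) d = G j' π w d)
    (hGd : ∀ j j' π w d, G j' π w (flipPair π (k j) d) = G j' π w d) :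
    Integrable (fun ω => (∑ j, r (sampleVec Y X n ω (sortPerm σ h X n ω (k j)))
        (D ω (sortPerm σ h X n ω (k j))) * G j (sortPerm σ h X n ω) (sampleVec Y X n ω) (D ω)) ^ 2)
        P ∧
      ∫ ω, (∑ j, r (sampleVec Y X n ω (sortPerm σ h X n ω (k j)))
        (D ω (sortPerm σ h X n ω (k j))) * G j (sortPerm σ h X n ω) (sampleVec Y X n ω) (D ω)) ^ 2
        ∂P ≤ C ^ 2 * (2 * n * ∫ x, (r x 0 ^ 2 + r x 1 ^ 2) ∂(unitLaw P Y X)) := by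
  classical
  set W := sampleVec Y X n with hW
  set S := sortPerm σ h X n with hS
  have hWm : Measurable W := hiid.measurable_sampleVec n
  have hSm : ∀ π, MeasurableSet {ω | S ω = π} := hσ.measurableSet_sortPerm hiid hh n
  have hDm : ∀ d, MeasurableSet {ω | D ω = d} :=
    fun d => hD.measurable_assignment (measurableSet_singleton d)
  set q : J → Ω → ℝ := fun j ω => r (W ω (S ω (k j))) (D ω (S ω (k j))) * G j (S ω) (W ω) (D ω)
    with hq
  have hkinj : Function.Injective k := by
    intro j j' hjj
    by_contra hne
    exact hk j j' hne (by rw [hjj])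
  have hrW : ∀ i a, MemLp (fun ω => r (W ω i) a) 2 P := fun i a => hiid.memLp_comp_unit (hr2 a) i
  have hqm : ∀ j, Measurable (q j) := fun j =>
    measurable_comp_of_finite (Ψ := fun π ω => r (W ω (π (k j))) (D ω (π (k j))) *
      G j π (W ω) (D ω)) hSm fun π =>
      measurable_comp_of_finite (Ψ := fun d ω => r (W ω (π (k j))) (d (π (k j))) *
        G j π (W ω) d) hDm fun d =>
        ((hr _).comp ((measurable_pi_apply _).comp hWm)).mul ((hG j π d).comp hWm)
  have hrle : ∀ x a, r x a ^ 2 ≤ r x 0 ^ 2 + r x 1 ^ 2 := by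
    intro x a
    fin_cases a
    · exact le_add_of_nonneg_right (sq_nonneg _)
    · exact le_add_of_nonneg_left (sq_nonneg _)
  have hq2 : ∀ j, MemLp (q j) 2 P := by
    intro j
    have hdom : MemLp (fun ω => ∑ i, ∑ a, C * |r (W ω i) a|) 2 P :=
      memLp_finsetSum _ fun i _ => memLp_finsetSum _ fun a _ => (hrW i a).abs.const_mul C
    refine hdom.mono (hqm j).aestronglyMeasurable (ae_of_all _ fun ω => ?_)
    have hC : 0 ≤ C := (abs_nonneg _).trans (hGC j (S ω) (W ω) (D ω))
    have hnn : ∀ i a, 0 ≤ C * |r (W ω i) a| := fun i a => mul_nonneg hC (abs_nonneg _)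
    rw [Real.norm_eq_abs, Real.norm_eq_abs,
      abs_of_nonneg (Finset.sum_nonneg fun i _ => Finset.sum_nonneg fun a _ => hnn i a), hq,
      abs_mul, mul_comm]
    calc _ ≤ C * |r (W ω (S ω (k j))) (D ω (S ω (k j)))| := by
          gcongr
          exact hGC _ _ _ _
      _ ≤ ∑ a, C * |r (W ω (S ω (k j))) a| :=
          Finset.single_le_sum (f := fun a => C * |r (W ω (S ω (k j))) a|)
            (fun a _ => hnn _ a) (Finset.mem_univ _)
      _ ≤ _ := Finset.single_le_sum (f := fun i => ∑ a, C * |r (W ω i) a|)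
            (fun i _ => Finset.sum_nonneg fun a _ => hnn i a) (Finset.mem_univ _)
  have hqq : ∀ j j', Integrable (fun ω => q j ω * q j' ω) P :=
    fun j j' => (hq2 j).integrable_mul (hq2 j')
  have horth : ∀ j j', j ≠ j' → ∫ ω, q j ω * q j' ω ∂P = 0 := by
    intro j j' hjj
    have hsplit : ∀ ω, q j ω * q j' ω
        = ∑ π, {ω | S ω = π}.indicator (fun ω => q j ω * q j' ω) ω := by
      intro ω
      rw [Finset.sum_eq_single (S ω)]
      · simp
      · intro π _ hπ
        exact Set.indicator_of_notMem (by simpa using hπ.symm) _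
      · simp
    rw [integral_congr_ae (ae_of_all P hsplit)]
    rw [integral_finsetSum _ fun π _ => (hqq j j').indicator (hSm π)]
    refine Finset.sum_eq_zero fun π _ => ?_
    have hne : π (k j') ≠ π (k j) := fun e => hjj (hkinj (π.injective e)).symm
    have hz := integral_centered_mul_eq_zero hiid hh hσ hD π (k j) hr hr0
      (G := fun w d => G j π w d * (r (w (π (k j'))) (d (π (k j'))) * G j' π w d))
      (fun d => (hG j π d).mul (((hr _).comp (measurable_pi_apply _)).mul (hG j' π d)))
      (fun w x d => by simp only [hGw, Function.update_of_ne hne])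
      (fun w d => by simp only [hGd, flipPair_of_ne π (k j) d (hk j' j hjj.symm)])
      (fun a d => by
        have h1 : Integrable (fun ω => r (W ω (π (k j))) a * r (W ω (π (k j'))) (d (π (k j')))) P :=
          (hrW _ _).integrable_mul (hrW _ _)
        have h2 := h1.bdd_mul (c := C * C) (f := fun ω => G j π (W ω) d * G j' π (W ω) d)
          (((hG j π d).comp hWm).mul ((hG j' π d).comp hWm)).aestronglyMeasurable
          (ae_of_all _ fun ω => by
            rw [norm_mul]
            exact mul_le_mul (hGC _ _ _ _) (hGC _ _ _ _) (norm_nonneg _)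
              ((abs_nonneg _).trans (hGC j π (W ω) d)))
        refine h2.congr (ae_of_all _ fun ω => ?_)
        change G j π (W ω) d * G j' π (W ω) d * (r (W ω (π (k j))) a *
          r (W ω (π (k j'))) (d (π (k j')))) = r (W ω (π (k j))) a *
          (G j π (W ω) d * (r (W ω (π (k j'))) (d (π (k j'))) * G j' π (W ω) d))
        ring)
    rw [← hz]
    refine integral_congr_ae (ae_of_all _ fun ω => ?_)
    by_cases hω : S ω = π
    · have h1 : (fun i : Fin (2 * n) => h (X i ω)) ∈ {z | σ n z = π} := hω
      simp only [Set.indicator_of_mem h1, Set.indicator_of_mem (show ω ∈ {ω | S ω = π} from hω),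
        hq, hω, Pi.one_apply]
      ring
    · have h1 : (fun i : Fin (2 * n) => h (X i ω)) ∉ {z | σ n z = π} := hω
      simp only [Set.indicator_of_notMem h1,
        Set.indicator_of_notMem (show ω ∉ {ω | S ω = π} from hω), zero_mul]
  have hexp : ∀ ω, (∑ j, q j ω) ^ 2 = ∑ j, ∑ j', q j ω * q j' ω := by
    intro ω
    rw [sq, Finset.sum_mul_sum]
  have hVint : Integrable (fun x => r x 0 ^ 2 + r x 1 ^ 2) (unitLaw P Y X) :=
    (hr2 0).integrable_sq.add (hr2 1).integrable_sq
  refine ⟨?_, ?_⟩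
  · change Integrable (fun ω => (∑ j, q j ω) ^ 2) P
    simp_rw [hexp]
    exact integrable_finsetSum _ fun j _ => integrable_finsetSum _ fun j' _ => hqq j j'
  · change ∫ ω, (∑ j, q j ω) ^ 2 ∂P ≤ _
    simp_rw [hexp]
    rw [integral_finsetSum _ fun j _ => integrable_finsetSum _ fun j' _ => hqq j j']
    have hdiag : ∀ j, ∫ ω, ∑ j', q j ω * q j' ω ∂P = ∫ ω, q j ω * q j ω ∂P := by
      intro j
      rw [integral_finsetSum _ fun j' _ => hqq j j', Finset.sum_eq_single j]
      · exact fun j' _ hj => horth j j' hj.symm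
      · simp
    simp_rw [hdiag]
    rw [← integral_finsetSum _ fun j _ => hqq j j,
      ← hiid.integral_sum_unit (V := fun x => r x 0 ^ 2 + r x 1 ^ 2)
        (((hr 0).pow_const 2).add ((hr 1).pow_const 2)) hVint,
      ← integral_const_mul]
    refine integral_mono (integrable_finsetSum _ fun j _ => hqq j j)
      ((hiid.integrable_sum_unit hVint n).const_mul _) fun ω => ?_
    have hC2 : 0 ≤ C ^ 2 := sq_nonneg C
    calc ∑ j, q j ω * q j ω
        ≤ ∑ j, C ^ 2 * (r (W ω (S ω (k j))) 0 ^ 2 + r (W ω (S ω (k j))) 1 ^ 2) := by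
          refine Finset.sum_le_sum fun j _ => ?_
          have hG2 : G j (S ω) (W ω) (D ω) ^ 2 ≤ C ^ 2 :=
            sq_le_sq' (abs_le.1 (hGC _ _ _ _)).1 (abs_le.1 (hGC _ _ _ _)).2
          calc q j ω * q j ω
              = G j (S ω) (W ω) (D ω) ^ 2 * r (W ω (S ω (k j))) (D ω (S ω (k j))) ^ 2 := by
                rw [hq]; ring
            _ ≤ _ := mul_le_mul hG2 (hrle _ _) (sq_nonneg _) hC2
      _ = C ^ 2 * ∑ j, (r (W ω (S ω (k j))) 0 ^ 2 + r (W ω (S ω (k j))) 1 ^ 2) := by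
          rw [Finset.mul_sum]
      _ ≤ _ := by
          refine mul_le_mul_of_nonneg_left ?_ hC2
          exact sum_comp_le_sum_of_injective (e := fun j => S ω (k j))
            (f := fun i => r (W ω i) 0 ^ 2 + r (W ω i) 1 ^ 2)
            ((S ω).injective.comp hkinj) fun i => by positivity

end SecondMoment

section LawsOfLargeNumbers

/-- Sums over `2 * n` units, grouped by pairs of consecutive units. -/
lemma sum_fin_two_mul {n : ℕ} (f : Fin (2 * n) → ℝ) :
    ∑ i, f i = ∑ s : Fin n, f ⟨2 * s, by omega⟩ + ∑ s : Fin n, f ⟨2 * s + 1, by omega⟩ := by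
  rw [← Equiv.sum_comp (finProdFinEquiv.trans (finCongr (Nat.mul_comm n 2))),
    Fintype.sum_prod_type, ← Finset.sum_add_distrib]
  refine Finset.sum_congr rfl fun s _ => ?_
  rw [Fin.sum_univ_two]
  congr 2 <;> ext <;> simp [finProdFinEquiv, add_comm]

variable {Ω 𝒳 : Type*} [MeasurableSpace Ω] [MeasurableSpace 𝒳]
  {P : Measure Ω} {Y : Fin 2 → ℕ → Ω → ℝ} {X : ℕ → Ω → 𝒳} {h : 𝒳 → ℝ}
  {σ : ∀ n : ℕ, (Fin (2 * n) → ℝ) → Equiv.Perm (Fin (2 * n))}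
  {D : ∀ n : ℕ, Ω → Fin (2 * n) → Fin 2}

/-- Weak law of large numbers for the whole sample. -/
lemma tendstoInMeasure_sampleMean [IsProbabilityMeasure P] (hiid : IsIIDSample P Y X)
    {V : ℝ × ℝ × 𝒳 → ℝ} (hVm : Measurable V) (hV : Integrable V (unitLaw P Y X)) :
    TendstoInMeasure P (fun (n : ℕ) ω => 1 / (2 * n : ℝ) * ∑ i, V (sampleVec Y X n ω i)) atTop
      (fun _ => ∫ x, V x ∂(unitLaw P Y X)) := by
  have hm : ∀ i, Measurable fun ω => V (Y 1 i ω, Y 0 i ω, X i ω) :=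
    fun i => hVm.comp (hiid.measurable_unit i)
  have hslln := strong_law_ae (μ := P) (fun i ω => V (Y 1 i ω, Y 0 i ω, X i ω))
    (hiid.integrable_comp_unit hV 0)
    (fun i j hij => (hiid.indep.indepFun hij).comp hVm hVm)
    (fun i => (hiid.ident i).comp hVm)
  refine tendstoInMeasure_of_tendsto_ae (fun n => ?_) ?_
  · have hsum : Measurable fun ω => ∑ i, V (sampleVec Y X n ω i) :=
      Finset.measurable_sum _ fun (i : Fin (2 * n)) _ => hm i
    exact (hsum.const_mul _).aestronglyMeasurable
  · filter_upwards [hslln] with ω hω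
    rw [hiid.integral_comp_unit hVm 0] at hω
    have hdouble : Tendsto (fun n : ℕ => 2 * n) atTop atTop :=
      tendsto_id.const_mul_atTop' (by norm_num)
    refine (hω.comp hdouble).congr fun n => ?_
    simp only [Function.comp_apply, Finset.sum_range, smul_eq_mul, Nat.cast_mul, Nat.cast_ofNat,
      one_div]
    rfl

/-- Law of large numbers for the units of one treatment arm. -/
lemma tendstoInMeasure_armMean [IsProbabilityMeasure P] (hiid : IsIIDSample P Y X)
    (hh : Measurable h) (hσ : IsSortingRule σ)
    (hD : ∀ n, AssignedHalf P Y X n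
      (fun x => pairStratification (σ n fun i => h (x i))) (D n))
    {V : ℝ × ℝ × 𝒳 → ℝ} (hVm : Measurable V) (hV : Integrable V (unitLaw P Y X)) (a : Fin 2) :
    TendstoInMeasure P
      (fun (n : ℕ) ω => (1 / n : ℝ) * ∑ i with D n ω i = a, V (sampleVec Y X n ω i)) atTop
      (fun _ => ∫ x, V x ∂(unitLaw P Y X)) := by
  have := hiid.isProbabilityMeasure_unitLaw
  set c : Fin 2 → ℝ := fun d => if d = a then 1 / 2 else -(1 / 2) with hc
  have hcabs : ∀ d, |c d| = 1 / 2 := by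
    intro d
    simp only [hc]
    split_ifs
    · exact abs_of_pos (by norm_num)
    · rw [abs_neg]; exact abs_of_pos (by norm_num)
  have hc0 : c 0 + c 1 = 0 := by
    fin_cases a <;> simp [hc]
  have hsplit : (fun (n : ℕ) ω => (1 / n : ℝ) * ∑ i with D n ω i = a, V (sampleVec Y X n ω i))
      = fun (n : ℕ) ω => (1 / n : ℝ) * ∑ i, c (D n ω i) * V (sampleVec Y X n ω i)
        + 1 / (2 * n : ℝ) * ∑ i, V (sampleVec Y X n ω i) := by
    ext n ω
    have h2 : 1 / (2 * n : ℝ) = (1 / n : ℝ) * (1 / 2) := by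
      rw [one_div_mul_one_div, mul_comm (2 : ℝ)]
    rw [h2, mul_assoc, ← mul_add, Finset.sum_filter]
    congr 1
    rw [Finset.mul_sum, ← Finset.sum_add_distrib]
    refine Finset.sum_congr rfl fun i _ => ?_
    simp only [hc]
    split_ifs <;> ring
  rw [hsplit, ← zero_add (∫ x, V x ∂(unitLaw P Y X))]
  refine tendstoInMeasure_const_add ?_ (tendstoInMeasure_sampleMean hiid hVm hV)
  refine tendstoInMeasure_zero_of_approx fun δ hδ => ?_
  obtain ⟨M, hM, htail⟩ := exists_integral_tail_le hV.abs hVm.abs hδ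
  set tail : ℝ × ℝ × 𝒳 → ℝ := {x | M < |V x|}.indicator fun x => |V x| with htaildef
  have hsetm : MeasurableSet {x | M < |V x|} := measurableSet_lt measurable_const hVm.abs
  have htm : Measurable tail := hVm.abs.indicator hsetm
  have hti : Integrable tail (unitLaw P Y X) := hV.abs.indicator hsetm
  set V₁ : ℝ × ℝ × 𝒳 → ℝ := {x | M < |V x|}ᶜ.indicator V with hV₁
  have hV₁m : Measurable V₁ := hVm.indicator hsetm.compl
  have hV₁M : ∀ x, |V₁ x| ≤ M := by
    intro x
    by_cases hx : M < |V x|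
    · rw [hV₁, Set.indicator_of_notMem (by simpa using hx), abs_zero]; exact hM
    · rw [hV₁, Set.indicator_of_mem (by simpa using hx)]; exact not_lt.1 hx
  have hVV : ∀ x, |V x - V₁ x| = tail x := by
    intro x
    by_cases hx : M < |V x|
    · rw [hV₁, htaildef, Set.indicator_of_notMem (by simpa using hx),
        Set.indicator_of_mem (by simpa using hx), sub_zero]
    · rw [hV₁, htaildef, Set.indicator_of_mem (by simpa using hx),
        Set.indicator_of_notMem (by simpa using hx), sub_self, abs_zero]
  set r : ℝ × ℝ × 𝒳 → Fin 2 → ℝ := fun x d => c d * V₁ x with hr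
  have hrm : ∀ d, Measurable fun x => r x d := fun d => hV₁m.const_mul _
  have hr2 : ∀ d, MemLp (fun x => r x d) 2 (unitLaw P Y X) := fun d =>
    (MemLp.of_bound hV₁m.aestronglyMeasurable M (ae_of_all _ hV₁M)).const_mul _
  have hr0 : ∀ B, MeasurableSet B →
      ∫ x in (fun x : ℝ × ℝ × 𝒳 => h x.2.2) ⁻¹' B, (r x 0 + r x 1) ∂(unitLaw P Y X) = 0 := by
    intro B _
    have : ∀ x, r x 0 + r x 1 = 0 := fun x => by rw [hr]; linear_combination V₁ x * hc0
    simp [this]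
  set K := ∫ x, (r x 0 ^ 2 + r x 1 ^ 2) ∂(unitLaw P Y X) with hK
  have hsq : ∀ n (k : Fin n → Fin (2 * n)),
      (∀ j j', j ≠ j' → (k j : ℕ) / 2 ≠ (k j' : ℕ) / 2) →
      Integrable (fun ω => (∑ j, r (sampleVec Y X n ω (sortPerm σ h X n ω (k j)))
        (D n ω (sortPerm σ h X n ω (k j)))) ^ 2) P ∧
      ∫ ω, (∑ j, r (sampleVec Y X n ω (sortPerm σ h X n ω (k j)))
        (D n ω (sortPerm σ h X n ω (k j)))) ^ 2 ∂P ≤ 2 * n * K := by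
    intro n k hk
    have hmain := integral_sq_sum_le hiid hh hσ (hD n) hk hrm hr2 hr0
      (G := fun _ _ _ _ => 1) (fun _ _ _ => measurable_const) (C := 1) (by simp) (by simp) (by simp)
    simpa only [mul_one, one_pow, one_mul] using hmain
  refine ⟨fun (n : ℕ) ω => (1 / n : ℝ) * ∑ i, r (sampleVec Y X n ω i) (D n ω i),
    fun (n : ℕ) ω => 1 / (2 * n : ℝ) * ∑ i, tail (sampleVec Y X n ω i), 8 * K, fun n hn => ?_⟩
  have hn' : (0 : ℝ) < n := by exact_mod_cast hn
  obtain ⟨hi0, hb0⟩ := hsq n (fun s => ⟨2 * s, by omega⟩) (fun s s' hss => by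
    have : (s : ℕ) ≠ s' := fun e => hss (Fin.ext e)
    simp only
    omega)
  obtain ⟨hi1, hb1⟩ := hsq n (fun s => ⟨2 * s + 1, by omega⟩) (fun s s' hss => by
    have : (s : ℕ) ≠ s' := fun e => hss (Fin.ext e)
    simp only
    omega)
  set S₀ : Ω → ℝ := fun ω => ∑ s : Fin n, r (sampleVec Y X n ω (sortPerm σ h X n ω ⟨2 * s, by omega⟩))
        (D n ω (sortPerm σ h X n ω ⟨2 * s, by omega⟩)) with hS₀
  set S₁ : Ω → ℝ := fun ω => ∑ s : Fin n,
      r (sampleVec Y X n ω (sortPerm σ h X n ω ⟨2 * s + 1, by omega⟩))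
        (D n ω (sortPerm σ h X n ω ⟨2 * s + 1, by omega⟩)) with hS₁
  have hsum : ∀ ω, ∑ i, r (sampleVec Y X n ω i) (D n ω i) = S₀ ω + S₁ ω := by
    intro ω
    rw [← Equiv.sum_comp (sortPerm σ h X n ω), sum_fin_two_mul]
  have hrmeas : Measurable fun ω => ∑ i, r (sampleVec Y X n ω i) (D n ω i) :=
    measurable_comp_of_finite (Ψ := fun d ω => ∑ i, r (sampleVec Y X n ω i) (d i))
      (fun d => (hD n).measurable_assignment (measurableSet_singleton d))
      fun d => Finset.measurable_sum _ fun i _ =>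
        (hrm _).comp ((measurable_pi_apply i).comp (hiid.measurable_sampleVec n))
  have hle : ∀ ω, ((1 / n : ℝ) * ∑ i, r (sampleVec Y X n ω i) (D n ω i)) ^ 2
      ≤ 2 / (n : ℝ) ^ 2 * (S₀ ω ^ 2 + S₁ ω ^ 2) := by
    intro ω
    rw [hsum, mul_pow, one_div, inv_pow, div_mul_eq_mul_div, inv_mul_eq_div]
    gcongr
    nlinarith [sq_nonneg (S₀ ω - S₁ ω)]
  have hdom : Integrable (fun ω => 2 / (n : ℝ) ^ 2 * (S₀ ω ^ 2 + S₁ ω ^ 2)) P :=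
    (hi0.add hi1).const_mul _
  have hAint : Integrable
      (fun ω => ((1 / n : ℝ) * ∑ i, r (sampleVec Y X n ω i) (D n ω i)) ^ 2) P :=
    hdom.mono' ((hrmeas.const_mul _).pow_const 2).aestronglyMeasurable
      (ae_of_all _ fun ω => by rw [Real.norm_eq_abs, abs_of_nonneg (sq_nonneg _)]; exact hle ω)
  refine ⟨fun ω => ?_, hAint, (hiid.integrable_sum_unit hti n).const_mul _, ?_, ?_⟩
  · have hdec : ∑ i, c (D n ω i) * V (sampleVec Y X n ω i)
        = ∑ i, r (sampleVec Y X n ω i) (D n ω i)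
          + ∑ i, c (D n ω i) * (V (sampleVec Y X n ω i) - V₁ (sampleVec Y X n ω i)) := by
      rw [← Finset.sum_add_distrib]
      exact Finset.sum_congr rfl fun i _ => by rw [hr]; ring
    rw [hdec, mul_add]
    refine (abs_add_le _ _).trans (add_le_add_right ?_ _)
    have h2 : 1 / (2 * n : ℝ) = (1 / n : ℝ) * (1 / 2) := by
      rw [one_div_mul_one_div, mul_comm (2 : ℝ)]
    rw [abs_mul, abs_of_pos (by positivity : (0 : ℝ) < 1 / n)]
    beta_reduce
    rw [h2, mul_assoc]
    refine mul_le_mul_of_nonneg_left ?_ (by positivity)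
    refine (Finset.abs_sum_le_sum_abs _ _).trans ?_
    rw [Finset.mul_sum]
    exact Finset.sum_le_sum fun i _ => by rw [abs_mul, hcabs, hVV]
  · calc _ ≤ ∫ ω, 2 / (n : ℝ) ^ 2 * (S₀ ω ^ 2 + S₁ ω ^ 2) ∂P := integral_mono hAint hdom hle
      _ = 2 / (n : ℝ) ^ 2 * (∫ ω, S₀ ω ^ 2 ∂P + ∫ ω, S₁ ω ^ 2 ∂P) := by
          rw [integral_const_mul, integral_add hi0 hi1]
      _ ≤ 2 / (n : ℝ) ^ 2 * (2 * n * K + 2 * n * K) := by gcongr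
      _ = 8 * K / n := by field_simp; ring
  · rw [integral_const_mul, hiid.integral_sum_unit htm hti]
    calc 1 / (2 * n : ℝ) * (2 * n * ∫ x, tail x ∂(unitLaw P Y X))
        = ∫ x, tail x ∂(unitLaw P Y X) := by field_simp
      _ ≤ δ := htail

/-- Averages of products over units in different pairs of the same group of four consecutive units
vanish asymptotically if one of the factors is centered given the score. -/
lemma tendstoInMeasure_crossMean [IsProbabilityMeasure P] (hiid : IsIIDSample P Y X)
    (hh : Measurable h) (hσ : IsSortingRule σ)
    (hD : ∀ n, AssignedHalf P Y X n
      (fun x => pairStratification (σ n fun i => h (x i))) (D n))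
    {r g : ℝ × ℝ × 𝒳 → Fin 2 → ℝ} (hr : ∀ a, Measurable fun x => r x a)
    (hr2 : ∀ a, MemLp (fun x => r x a) 2 (unitLaw P Y X))
    (hr0 : ∀ B, MeasurableSet B →
      ∫ x in (fun x : ℝ × ℝ × 𝒳 => h x.2.2) ⁻¹' B, (r x 0 + r x 1) ∂(unitLaw P Y X) = 0)
    (hg : ∀ a, Measurable fun x => g x a)
    (hg2 : ∀ a, MemLp (fun x => g x a) 2 (unitLaw P Y X))
    {k l : ∀ n : ℕ, Fin (n / 2) → Fin (2 * n)} (hk : ∀ n j, (k n j : ℕ) / 4 = j)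
    (hl : ∀ n j, (l n j : ℕ) / 4 = j) (hkl : ∀ n j, (k n j : ℕ) / 2 ≠ (l n j : ℕ) / 2) :
    TendstoInMeasure P (fun (n : ℕ) ω => (1 / n : ℝ) * ∑ j,
      r (sampleVec Y X n ω (sortPerm σ h X n ω (k n j))) (D n ω (sortPerm σ h X n ω (k n j))) *
      g (sampleVec Y X n ω (sortPerm σ h X n ω (l n j))) (D n ω (sortPerm σ h X n ω (l n j))))
      atTop (fun _ => 0) := by
  have := hiid.isProbabilityMeasure_unitLaw
  refine tendstoInMeasure_zero_of_approx fun δ hδ => ?_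
  have hle2 : ∀ (f : ℝ × ℝ × 𝒳 → Fin 2 → ℝ) x a, f x a ^ 2 ≤ f x 0 ^ 2 + f x 1 ^ 2 := by
    intro f x a
    fin_cases a
    · exact le_add_of_nonneg_right (sq_nonneg _)
    · exact le_add_of_nonneg_left (sq_nonneg _)
  set ρ : ℝ × ℝ × 𝒳 → ℝ := fun x => r x 0 ^ 2 + r x 1 ^ 2 with hρ
  set γ : ℝ × ℝ × 𝒳 → ℝ := fun x => g x 0 ^ 2 + g x 1 ^ 2 with hγ
  have hρm : Measurable ρ := ((hr 0).pow_const 2).add ((hr 1).pow_const 2)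
  have hγm : Measurable γ := ((hg 0).pow_const 2).add ((hg 1).pow_const 2)
  have hρi : Integrable ρ (unitLaw P Y X) := (hr2 0).integrable_sq.add (hr2 1).integrable_sq
  have hγi : Integrable γ (unitLaw P Y X) := (hg2 0).integrable_sq.add (hg2 1).integrable_sq
  have hρ0 : ∀ x, 0 ≤ ρ x := fun x => by positivity
  have hγ0 : ∀ x, 0 ≤ γ x := fun x => by positivity
  set R := ∫ x, ρ x ∂(unitLaw P Y X) with hR
  have hR0 : 0 ≤ R := integral_nonneg hρ0
  set η := δ / (2 * (R + 1)) with hη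
  have hη0 : 0 < η := by positivity
  obtain ⟨M, hM, htail⟩ := exists_integral_tail_le hγi hγm (δ := η * (δ / 2)) (by positivity)
  set tail : ℝ × ℝ × 𝒳 → ℝ := {x | M < γ x}.indicator γ with htaildef
  have hsetm : MeasurableSet {x | M < γ x} := measurableSet_lt measurable_const hγm
  have htm : Measurable tail := hγm.indicator hsetm
  have hti : Integrable tail (unitLaw P Y X) := hγi.indicator hsetm
  have ht0 : ∀ x, 0 ≤ tail x := fun x => Set.indicator_nonneg (fun x _ => hγ0 x) x
  set g₁ : ℝ × ℝ × 𝒳 → Fin 2 → ℝ := fun x a => {x | M < γ x}ᶜ.indicator (fun x => g x a) x with hg₁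
  have hg₁m : ∀ a, Measurable fun x => g₁ x a := fun a => (hg a).indicator hsetm.compl
  have hg₁M : ∀ x a, |g₁ x a| ≤ √M := by
    intro x a
    by_cases hx : M < γ x
    · simp only [hg₁]
      rw [Set.indicator_of_notMem (by simpa using hx), abs_zero]
      exact Real.sqrt_nonneg _
    · simp only [hg₁]
      rw [Set.indicator_of_mem (by simpa using hx)]
      exact Real.abs_le_sqrt ((hle2 g x a).trans (not_lt.1 hx))
  have hgg : ∀ x a, (g x a - g₁ x a) ^ 2 ≤ tail x := by
    intro x a
    by_cases hx : M < γ x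
    · simp only [hg₁, htaildef]
      rw [Set.indicator_of_notMem (by simpa using hx), Set.indicator_of_mem (by simpa using hx),
        sub_zero]
      exact hle2 g x a
    · simp only [hg₁, htaildef]
      rw [Set.indicator_of_mem (by simpa using hx), Set.indicator_of_notMem (by simpa using hx),
        sub_self]
      simp
  refine ⟨fun (n : ℕ) ω => (1 / n : ℝ) * ∑ j,
      r (sampleVec Y X n ω (sortPerm σ h X n ω (k n j))) (D n ω (sortPerm σ h X n ω (k n j))) *
      g₁ (sampleVec Y X n ω (sortPerm σ h X n ω (l n j))) (D n ω (sortPerm σ h X n ω (l n j))),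
    fun (n : ℕ) ω => 1 / (2 * n : ℝ) * (η * ∑ i, ρ (sampleVec Y X n ω i)
      + η⁻¹ * ∑ i, tail (sampleVec Y X n ω i)), 2 * M * R, fun n hn => ?_⟩
  have hn' : (0 : ℝ) < n := by exact_mod_cast hn
  have hkinj : Function.Injective (k n) := fun j j' e => Fin.ext (by rw [← hk, ← hk, e])
  have hlinj : Function.Injective (l n) := fun j j' e => Fin.ext (by rw [← hl, ← hl, e])
  have hkk : ∀ j j', j ≠ j' → (k n j : ℕ) / 2 ≠ (k n j' : ℕ) / 2 := by
    intro j j' hjj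
    have h1 := hk n j
    have h2 := hk n j'
    have : (j : ℕ) ≠ j' := fun e => hjj (Fin.ext e)
    omega
  have hlk : ∀ j j', (l n j' : ℕ) / 2 ≠ (k n j : ℕ) / 2 := by
    intro j j' e
    have h1 := hk n j
    have h2 := hl n j'
    have hjj : j = j' := Fin.ext (by omega)
    subst hjj
    exact hkl n j e.symm
  obtain ⟨hint, hbd⟩ := integral_sq_sum_le hiid hh hσ (hD n) hkk hr hr2 hr0
    (G := fun j π w d => g₁ (w (π (l n j))) (d (π (l n j))))
    (fun j π d => (hg₁m _).comp (measurable_pi_apply _)) (C := √M) (fun _ _ _ _ => hg₁M _ _)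
    (fun j j' π w x d => by
      have hne : π (l n j') ≠ π (k n j) := fun e => hlk j j' (by rw [π.injective e])
      simp only [Function.update_of_ne hne])
    (fun j j' π w d => by simp only [flipPair_of_ne π (k n j) d (hlk j j')])
  have hρs := (hiid.integrable_sum_unit hρi n).const_mul η
  have hts := (hiid.integrable_sum_unit hti n).const_mul η⁻¹
  refine ⟨fun ω => ?_, ?_, (hρs.add hts).const_mul _, ?_, ?_⟩
  · set W := sampleVec Y X n ω
    set S := sortPerm σ h X n ω
    set d := D n ω
    have hdec : ∑ j, r (W (S (k n j))) (d (S (k n j))) * g (W (S (l n j))) (d (S (l n j)))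
        = ∑ j, r (W (S (k n j))) (d (S (k n j))) * g₁ (W (S (l n j))) (d (S (l n j)))
          + ∑ j, r (W (S (k n j))) (d (S (k n j))) *
            (g (W (S (l n j))) (d (S (l n j))) - g₁ (W (S (l n j))) (d (S (l n j)))) := by
      rw [← Finset.sum_add_distrib]
      exact Finset.sum_congr rfl fun i _ => by ring
    rw [hdec, mul_add]
    refine (abs_add_le _ _).trans (add_le_add_right ?_ _)
    have h2 : 1 / (2 * n : ℝ) = (1 / n : ℝ) * (1 / 2) := by
      rw [one_div_mul_one_div, mul_comm (2 : ℝ)]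
    rw [abs_mul, abs_of_pos (by positivity : (0 : ℝ) < 1 / n)]
    beta_reduce
    rw [h2, mul_assoc]
    refine mul_le_mul_of_nonneg_left ?_ (by positivity)
    refine (Finset.abs_sum_le_sum_abs _ _).trans ?_
    have hterm : ∀ j, |r (W (S (k n j))) (d (S (k n j))) *
        (g (W (S (l n j))) (d (S (l n j))) - g₁ (W (S (l n j))) (d (S (l n j))))|
        ≤ 1 / 2 * (η * ρ (W (S (k n j))) + η⁻¹ * tail (W (S (l n j)))) := by
      intro j
      have h1 := hle2 r (W (S (k n j))) (d (S (k n j)))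
      have h2 := hgg (W (S (l n j))) (d (S (l n j)))
      generalize r (W (S (k n j))) (d (S (k n j))) = u at h1 ⊢
      generalize g (W (S (l n j))) (d (S (l n j))) - g₁ (W (S (l n j))) (d (S (l n j))) = v at h2 ⊢
      have hamgm : |u * v| ≤ 1 / 2 * (η * u ^ 2 + η⁻¹ * v ^ 2) := by
        have hkey : 0 ≤ η⁻¹ * (η * |u| - |v|) ^ 2 := by positivity
        have hexp : η⁻¹ * (η * |u| - |v|) ^ 2
            = η * u ^ 2 + η⁻¹ * v ^ 2 - 2 * |u * v| := by
          rw [abs_mul, ← sq_abs u, ← sq_abs v]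
          field_simp
          ring
        linarith
      refine hamgm.trans ?_
      gcongr
    refine (Finset.sum_le_sum fun j _ => hterm j).trans ?_
    rw [← Finset.mul_sum, Finset.sum_add_distrib, ← Finset.mul_sum, ← Finset.mul_sum]
    have hs1 := sum_comp_le_sum_of_injective (e := fun j => S (k n j)) (f := fun i => ρ (W i))
      (S.injective.comp hkinj) fun i => hρ0 _
    have hs2 := sum_comp_le_sum_of_injective (e := fun j => S (l n j)) (f := fun i => tail (W i))
      (S.injective.comp hlinj) fun i => ht0 _
    gcongr
  · simp_rw [mul_pow]
    exact hint.const_mul _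
  · simp_rw [mul_pow]
    rw [integral_const_mul]
    calc _ ≤ (1 / (n : ℝ)) ^ 2 * (√M ^ 2 * (2 * n * R)) := by gcongr
      _ = 2 * M * R / n := by rw [Real.sq_sqrt hM]; field_simp
  · rw [integral_const_mul, integral_add hρs hts, integral_const_mul, integral_const_mul,
      hiid.integral_sum_unit htm hti, hiid.integral_sum_unit hρm hρi]
    calc 1 / (2 * n : ℝ) * (η * (2 * n * R) + η⁻¹ * (2 * n * ∫ x, tail x ∂(unitLaw P Y X)))
        = η * R + η⁻¹ * ∫ x, tail x ∂(unitLaw P Y X) := by field_simp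
      _ ≤ η * (R + 1) + η⁻¹ * (η * (δ / 2)) := by gcongr; linarith
      _ = δ := by rw [hη]; field_simp; ring

end LawsOfLargeNumbers

section Sorted

lemma LipschitzWith.sq_le {φ : ℝ → ℝ} {K : NNReal} (hφ : LipschitzWith K φ) (z : ℝ) :
    φ z ^ 2 ≤ 2 * φ 0 ^ 2 + 2 * (K : ℝ) ^ 2 * z ^ 2 := by
  have h := hφ.dist_le_mul z 0
  rw [Real.dist_eq, Real.dist_eq, sub_zero] at h
  have h2 : (φ z - φ 0) ^ 2 ≤ (K : ℝ) ^ 2 * z ^ 2 := by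
    rw [← sq_abs (φ z - φ 0), ← sq_abs z, ← mul_pow]
    gcongr
  nlinarith [sq_nonneg (φ z - 2 * φ 0)]

/-- For a Lipschitz function `ψ` of a bounded monotone sequence, products of sums over consecutive
pairs are close to sums of squares. -/
lemma abs_sum_pairs_sub_sum_sq_le {ψ : ℝ → ℝ} {K : NNReal} (hψ : LipschitzWith K ψ) {u : ℕ → ℝ}
    (hu : Monotone u) {B : ℝ} (hB : ∀ k, u k ^ 2 ≤ B) {J N : ℕ} (hJN : 4 * J ≤ N)
    (hNJ : N ≤ 4 * J + 2) :
    |∑ j ∈ Finset.range J, (ψ (u (4 * j)) + ψ (u (4 * j + 1))) *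
        (ψ (u (4 * j + 2)) + ψ (u (4 * j + 3))) - ∑ k ∈ Finset.range N, ψ (u k) ^ 2|
      ≤ (12 * (K : ℝ) ^ 2 + 4 * ψ 0 ^ 2) * (1 + B) := by
  have hB0 : 0 ≤ B := (sq_nonneg _).trans (hB 0)
  have hquad : ∀ j, |(ψ (u (4 * j)) + ψ (u (4 * j + 1))) * (ψ (u (4 * j + 2)) + ψ (u (4 * j + 3)))
      - (ψ (u (4 * j)) ^ 2 + ψ (u (4 * j + 1)) ^ 2 + ψ (u (4 * j + 2)) ^ 2
        + ψ (u (4 * j + 3)) ^ 2)| ≤ 2 * (K : ℝ) ^ 2 * (u (4 * (j + 1)) - u (4 * j)) ^ 2 := by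
    intro j
    have hd : ∀ p q, 4 * j ≤ p → p ≤ q → q ≤ 4 * (j + 1) →
        (ψ (u p) - ψ (u q)) ^ 2 ≤ (K : ℝ) ^ 2 * (u (4 * (j + 1)) - u (4 * j)) ^ 2 := by
      intro p q h1 h2 h3
      have hl := hψ.dist_le_mul (u p) (u q)
      rw [Real.dist_eq, Real.dist_eq] at hl
      have hab : |u p - u q| ≤ u (4 * (j + 1)) - u (4 * j) := by
        rw [abs_sub_comm, abs_of_nonneg (sub_nonneg.2 (hu h2))]
        linarith [hu h1, hu h3]
      rw [← sq_abs, ← mul_pow]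
      gcongr
      exact hl.trans (by gcongr)
    have h02 := hd (4 * j) (4 * j + 2) (by omega) (by omega) (by omega)
    have h03 := hd (4 * j) (4 * j + 3) (by omega) (by omega) (by omega)
    have h12 := hd (4 * j + 1) (4 * j + 2) (by omega) (by omega) (by omega)
    have h13 := hd (4 * j + 1) (4 * j + 3) (by omega) (by omega) (by omega)
    generalize ψ (u (4 * j)) = a at *
    generalize ψ (u (4 * j + 1)) = b at *
    generalize ψ (u (4 * j + 2)) = c at *
    generalize ψ (u (4 * j + 3)) = d at *
    have hid : (a + b) * (c + d) - (a ^ 2 + b ^ 2 + c ^ 2 + d ^ 2)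
        = -(1 / 2 * ((a - c) ^ 2 + (a - d) ^ 2 + (b - c) ^ 2 + (b - d) ^ 2)) := by ring
    rw [hid, abs_neg, abs_of_nonneg (by positivity)]
    linarith
  have htel : ∑ j ∈ Finset.range J, (u (4 * (j + 1)) - u (4 * j)) ^ 2 ≤ 4 * B := by
    calc _ ≤ (∑ j ∈ Finset.range J, (u (4 * (j + 1)) - u (4 * j))) ^ 2 :=
          Finset.sum_sq_le_sq_sum_of_nonneg fun j _ => sub_nonneg.2 (hu (by omega))
      _ = (u (4 * J) - u 0) ^ 2 := by
          rw [Finset.sum_range_sub (fun j => u (4 * j))]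
      _ ≤ 4 * B := by nlinarith [sq_nonneg (u (4 * J) + u 0), hB (4 * J), hB 0]
  have hgroup : ∀ f : ℕ → ℝ, ∑ k ∈ Finset.range (4 * J), f k
      = ∑ j ∈ Finset.range J, (f (4 * j) + f (4 * j + 1) + f (4 * j + 2) + f (4 * j + 3)) := by
    intro f
    clear htel hJN hNJ
    induction J with
    | zero => simp
    | succ J ih =>
      rw [Finset.sum_range_succ, ← ih, show 4 * (J + 1) = 4 * J + 1 + 1 + 1 + 1 by ring]
      simp only [Finset.sum_range_succ]
      ring
  have hrest : ∑ k ∈ Finset.range N, ψ (u k) ^ 2 - ∑ k ∈ Finset.range (4 * J), ψ (u k) ^ 2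
      ≤ 2 * (2 * ψ 0 ^ 2 + 2 * (K : ℝ) ^ 2 * B) := by
    rw [← Finset.sum_Ico_eq_sub _ hJN]
    have hψB : ∀ k, ψ (u k) ^ 2 ≤ 2 * ψ 0 ^ 2 + 2 * (K : ℝ) ^ 2 * B := fun k =>
      (hψ.sq_le (u k)).trans (by gcongr; exact hB k)
    calc _ ≤ (Finset.Ico (4 * J) N).card • (2 * ψ 0 ^ 2 + 2 * (K : ℝ) ^ 2 * B) :=
          Finset.sum_le_card_nsmul _ _ _ fun k _ => hψB k
      _ ≤ _ := by
          rw [Nat.card_Ico, nsmul_eq_mul]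
          gcongr
          have : N - 4 * J ≤ 2 := by omega
          exact_mod_cast this
  have hrest0 : 0 ≤ ∑ k ∈ Finset.range N, ψ (u k) ^ 2
      - ∑ k ∈ Finset.range (4 * J), ψ (u k) ^ 2 := by
    rw [← Finset.sum_Ico_eq_sub _ hJN]
    exact Finset.sum_nonneg fun k _ => sq_nonneg _
  have hmain : |∑ j ∈ Finset.range J, (ψ (u (4 * j)) + ψ (u (4 * j + 1))) *
        (ψ (u (4 * j + 2)) + ψ (u (4 * j + 3))) - ∑ k ∈ Finset.range (4 * J), ψ (u k) ^ 2|
      ≤ 2 * (K : ℝ) ^ 2 * (4 * B) := by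
    rw [hgroup, ← Finset.sum_sub_distrib]
    refine (Finset.abs_sum_le_sum_abs _ _).trans ((Finset.sum_le_sum fun j _ => hquad j).trans ?_)
    rw [← Finset.mul_sum]
    gcongr
  have hK0 : 0 ≤ (K : ℝ) ^ 2 := sq_nonneg _
  have hψ0 : 0 ≤ ψ 0 ^ 2 * B := by positivity
  rw [abs_le] at hmain ⊢
  constructor <;> nlinarith [hmain.1, hmain.2]

variable {Ω 𝒳 : Type*} [MeasurableSpace Ω] [MeasurableSpace 𝒳]
  {P : Measure Ω} {Y : Fin 2 → ℕ → Ω → ℝ} {X : ℕ → Ω → 𝒳} {h : 𝒳 → ℝ}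
  {σ : ∀ n : ℕ, (Fin (2 * n) → ℝ) → Equiv.Perm (Fin (2 * n))}

/-- The products over consecutive pairs of the sorted sample, for a Lipschitz function of the
score. -/
lemma tendstoInMeasure_pairProducts [IsProbabilityMeasure P] (hiid : IsIIDSample P Y X)
    (hh : Measurable h) (hσ : IsSortingRule σ)
    (hh2 : MemLp (fun x : ℝ × ℝ × 𝒳 => h x.2.2) 2 (unitLaw P Y X))
    {ψ : ℝ → ℝ} {K : NNReal} (hψ : LipschitzWith K ψ)
    (hψ2 : MemLp (fun x : ℝ × ℝ × 𝒳 => ψ (h x.2.2)) 2 (unitLaw P Y X)) :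
    TendstoInMeasure P (fun (n : ℕ) ω => 1 / (2 * n : ℝ) * ∑ j : Fin (n / 2),
      (ψ (h (X (sortPerm σ h X n ω ⟨4 * j, by omega⟩) ω))
        + ψ (h (X (sortPerm σ h X n ω ⟨4 * j + 1, by omega⟩) ω))) *
      (ψ (h (X (sortPerm σ h X n ω ⟨4 * j + 2, by omega⟩) ω))
        + ψ (h (X (sortPerm σ h X n ω ⟨4 * j + 3, by omega⟩) ω)))) atTop
      (fun _ => ∫ x, ψ (h x.2.2) ^ 2 ∂(unitLaw P Y X)) := by
  have hζ : Measurable fun x : ℝ × ℝ × 𝒳 => h x.2.2 := by fun_prop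
  have hmean := tendstoInMeasure_sampleMean hiid (V := fun x => ψ (h x.2.2) ^ 2)
    ((hψ.continuous.measurable.comp hζ).pow_const 2) hψ2.integrable_sq
  set L : ℕ → Ω → ℝ := fun n ω => 1 / (2 * n : ℝ) * ∑ i, ψ (h (sampleVec Y X n ω i).2.2) ^ 2
    with hL
  set T : ℕ → Ω → ℝ := fun (n : ℕ) ω => 1 / (2 * n : ℝ) * ∑ j : Fin (n / 2),
      (ψ (h (X (sortPerm σ h X n ω ⟨4 * j, by omega⟩) ω))
        + ψ (h (X (sortPerm σ h X n ω ⟨4 * j + 1, by omega⟩) ω))) *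
      (ψ (h (X (sortPerm σ h X n ω ⟨4 * j + 2, by omega⟩) ω))
        + ψ (h (X (sortPerm σ h X n ω ⟨4 * j + 3, by omega⟩) ω))) with hT
  have hsplit : T = fun n ω => (T n ω - L n ω) + L n ω := by
    ext n ω
    ring
  rw [hsplit, ← zero_add (∫ x, ψ (h x.2.2) ^ 2 ∂(unitLaw P Y X))]
  refine tendstoInMeasure_const_add (tendstoInMeasure_zero_of_dominated fun δ hδ => ?_) hmean
  set C : ℝ := 12 * (K : ℝ) ^ 2 + 4 * ψ 0 ^ 2 with hC
  have hC0 : 0 ≤ C := by positivity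
  have hsqm : Measurable fun x : ℝ × ℝ × 𝒳 => h x.2.2 ^ 2 := hζ.pow_const 2
  obtain ⟨M, hM, htail⟩ := exists_integral_tail_le hh2.integrable_sq hsqm
    (δ := δ / (2 * (C + 1))) (by positivity)
  set tail : ℝ × ℝ × 𝒳 → ℝ := {x | M < h x.2.2 ^ 2}.indicator fun x => h x.2.2 ^ 2 with htaildef
  have hsetm : MeasurableSet {x : ℝ × ℝ × 𝒳 | M < h x.2.2 ^ 2} :=
    measurableSet_lt measurable_const hsqm
  have htm : Measurable tail := hsqm.indicator hsetm
  have hti : Integrable tail (unitLaw P Y X) := hh2.integrable_sq.indicator hsetm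
  have ht0 : ∀ x, 0 ≤ tail x := fun x => Set.indicator_nonneg (fun x _ => sq_nonneg _) x
  have hle : ∀ x : ℝ × ℝ × 𝒳, h x.2.2 ^ 2 ≤ M + tail x := by
    intro x
    by_cases hx : M < h x.2.2 ^ 2
    · rw [htaildef, Set.indicator_of_mem (by simpa using hx)]
      linarith
    · rw [htaildef, Set.indicator_of_notMem (by simpa using hx)]
      linarith [not_lt.1 hx]
  have hlim : Tendsto (fun n : ℕ => C * (1 + M) / 2 / n) atTop (𝓝 0) :=
    tendsto_const_div_atTop_nhds_zero_nat _
  filter_upwards [eventually_gt_atTop 0, hlim.eventually (gt_mem_nhds (half_pos hδ))] with n hn hnM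
  have hn' : (0 : ℝ) < n := by exact_mod_cast hn
  have hts := hiid.integrable_sum_unit hti n
  have hBint : Integrable (fun ω => M + ∑ i, tail (sampleVec Y X n ω i)) P :=
    (integrable_const M).add hts
  have hBint1 : Integrable (fun ω => 1 + (M + ∑ i, tail (sampleVec Y X n ω i))) P :=
    (integrable_const 1).add hBint
  refine ⟨fun ω => 1 / (2 * n : ℝ) * (C * (1 + (M + ∑ i, tail (sampleVec Y X n ω i)))),
    (hBint1.const_mul C).const_mul _, fun ω => ?_, ?_⟩
  · set S := sortPerm σ h X n ω with hS
    set u : ℕ → ℝ := fun k => h (X (S ⟨min k (2 * n - 1), by omega⟩) ω) with hu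
    have humono : Monotone u := by
      intro a b hab
      have hs := hσ.sorted n (fun i => h (X i ω))
      exact hs (show (⟨min a (2 * n - 1), by omega⟩ : Fin (2 * n)) ≤ ⟨min b (2 * n - 1), by omega⟩
        from by
          simp only [Fin.mk_le_mk]
          omega)
    have huB : ∀ k, u k ^ 2 ≤ M + ∑ i, tail (sampleVec Y X n ω i) := by
      intro k
      refine (hle (sampleVec Y X n ω (S ⟨min k (2 * n - 1), by omega⟩))).trans ?_
      gcongr
      exact Finset.single_le_sum (f := fun i => tail (sampleVec Y X n ω i)) (fun i _ => ht0 _)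
        (Finset.mem_univ _)
    have hdet := abs_sum_pairs_sub_sum_sq_le hψ humono huB (J := n / 2) (N := 2 * n)
      (by omega) (by omega)
    have hueq : ∀ k (hk : k < 2 * n), h (X (S ⟨k, hk⟩) ω) = u k := by
      intro k hk
      have : min k (2 * n - 1) = k := by omega
      simp only [hu, this]
    have hTu : T n ω = 1 / (2 * n : ℝ) * ∑ j ∈ Finset.range (n / 2),
        (ψ (u (4 * j)) + ψ (u (4 * j + 1))) * (ψ (u (4 * j + 2)) + ψ (u (4 * j + 3))) := by
      rw [Finset.sum_range]
      simp only [hT, ← hS, hueq]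
    have hLu : L n ω = 1 / (2 * n : ℝ) * ∑ k ∈ Finset.range (2 * n), ψ (u k) ^ 2 := by
      rw [Finset.sum_range]
      simp only [hL]
      rw [← Equiv.sum_comp S]
      congr 1
      refine Finset.sum_congr rfl fun k _ => ?_
      rw [← hueq k k.isLt]
      rfl
    rw [hTu, hLu, ← mul_sub, abs_mul, abs_of_pos (by positivity : (0 : ℝ) < 1 / (2 * n))]
    exact mul_le_mul_of_nonneg_left hdet (by positivity)
  · rw [integral_const_mul, integral_const_mul, integral_add (integrable_const _) hBint,
      integral_add (integrable_const _) hts, hiid.integral_sum_unit htm hti]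
    simp only [integral_const, probReal_univ, smul_eq_mul, one_mul]
    calc 1 / (2 * n : ℝ) * (C * (1 + (M + 2 * n * ∫ x, tail x ∂(unitLaw P Y X))))
        = C * (1 + M) / 2 / n + C * ∫ x, tail x ∂(unitLaw P Y X) := by
          field_simp
          ring
      _ ≤ δ / 2 + (C + 1) * (δ / (2 * (C + 1))) := by
          have h1 : C * ∫ x, tail x ∂(unitLaw P Y X) ≤ (C + 1) * (δ / (2 * (C + 1))) := by
            gcongr
            · exact integral_nonneg ht0
            · linarith
          linarith
      _ = δ := by field_simp; ring

end Sorted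

section Estimator

/-- The sample variance of one arm in terms of uncentered moments. -/
lemma sigmaSqHat_eq (n : ℕ) (y : Fin (2 * n) → ℝ) (d : Fin (2 * n) → Fin 2) (a : Fin 2) :
    sigmaSqHat n y d a = (1 / n : ℝ) * (∑ i with d i = a, y i ^ 2)
      + (-2 * (muHat n y d a * muHat n y d a)
        + muHat n y d a * muHat n y d a * ((1 / n : ℝ) * ∑ i with d i = a, (1 : ℝ))) := by
  have h : ∀ m : ℝ, ∑ i with d i = a, (y i - m) ^ 2
      = (∑ i with d i = a, y i ^ 2) + (-2 * m * ∑ i with d i = a, y i)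
        + m ^ 2 * ∑ i with d i = a, (1 : ℝ) := by
    intro m
    rw [Finset.mul_sum, Finset.mul_sum, ← Finset.sum_add_distrib, ← Finset.sum_add_distrib]
    exact Finset.sum_congr rfl fun i _ => by ring
  unfold sigmaSqHat
  rw [h]
  unfold muHat
  ring

variable {Ω 𝒳 : Type*} {Y : Fin 2 → ℕ → Ω → ℝ} {X : ℕ → Ω → 𝒳}

/-- The potential outcomes as a function of the unit and of its treatment status. -/
def outcome (x : ℝ × ℝ × 𝒳) (a : Fin 2) : ℝ := if a = 1 then x.1 else x.2.1

lemma outcome_unit (a : Fin 2) (i : ℕ) (ω : Ω) :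
    outcome (Y 1 i ω, Y 0 i ω, X i ω) a = Y a i ω := by
  fin_cases a <;> rfl

lemma outcome_sampleVec (n : ℕ) (ω : Ω) (i : Fin (2 * n)) (a : Fin 2) :
    outcome (sampleVec Y X n ω i) a = Y a i ω :=
  outcome_unit a i ω

variable [MeasurableSpace Ω] [MeasurableSpace 𝒳] {P : Measure Ω} {h : 𝒳 → ℝ}
  {σ : ∀ n : ℕ, (Fin (2 * n) → ℝ) → Equiv.Perm (Fin (2 * n))}
  {D : ∀ n : ℕ, Ω → Fin (2 * n) → Fin 2}

lemma measurable_outcome (a : Fin 2) : Measurable fun x : ℝ × ℝ × 𝒳 => outcome x a := by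
  unfold outcome
  split_ifs <;> fun_prop

lemma IsIIDSample.memLp_unitLaw (hiid : IsIIDSample P Y X) {V : ℝ × ℝ × 𝒳 → ℝ}
    (hV : Measurable V) (hV2 : MemLp (fun ω => V (Y 1 0 ω, Y 0 0 ω, X 0 ω)) 2 P) :
    MemLp V 2 (unitLaw P Y X) :=
  (memLp_map_measure_iff hV.aestronglyMeasurable (hiid.measurable_unit 0).aemeasurable).2 hV2

lemma LipschitzWith.memLp_comp [IsFiniteMeasure P] {φ : ℝ → ℝ} {K : NNReal}
    (hφ : LipschitzWith K φ) {Z : Ω → ℝ} (hZ : MemLp Z 2 P) : MemLp (fun ω => φ (Z ω)) 2 P := by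
  have hdom : MemLp (fun ω => |φ 0| + K * |Z ω|) 2 P :=
    (memLp_const |φ 0|).add (hZ.abs.const_mul (K : ℝ))
  refine hdom.mono (hφ.continuous.comp_aestronglyMeasurable hZ.1) (ae_of_all _ fun ω => ?_)
  have hl := hφ.dist_le_mul (Z ω) 0
  rw [Real.dist_eq, Real.dist_eq, sub_zero] at hl
  have habs : |φ (Z ω)| ≤ |φ 0| + |φ (Z ω) - φ 0| := by
    simpa using abs_add_le (φ 0) (φ (Z ω) - φ 0)
  rw [Real.norm_eq_abs, Real.norm_eq_abs]
  exact (habs.trans (by gcongr)).trans (le_abs_self _)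

/-- The mean outcome of one treatment arm is consistent. -/
lemma tendstoInMeasure_muHat [IsProbabilityMeasure P] (hiid : IsIIDSample P Y X)
    (hh : Measurable h) (hσ : IsSortingRule σ)
    (hD : ∀ n, AssignedHalf P Y X n
      (fun x => pairStratification (σ n fun i => h (x i))) (D n))
    (hmom : ∀ d, MemLp (Y d 0) 2 P) (a : Fin 2) :
    TendstoInMeasure P
      (fun n ω => muHat n (fun i => Y (D n ω i) i ω) (D n ω) a) atTop
      (fun _ => ∫ ω, Y a 0 ω ∂P) := by
  have hm := measurable_outcome (𝒳 := 𝒳) a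
  have := hiid.isProbabilityMeasure_unitLaw
  have hi : Integrable (fun x => outcome x a) (unitLaw P Y X) :=
    (hiid.memLp_unitLaw hm (by simpa only [outcome_unit] using hmom a)).integrable one_le_two
  have hmain := tendstoInMeasure_armMean hiid hh hσ hD hm hi a
  rw [← hiid.integral_comp_unit hm 0] at hmain
  simp only [outcome_unit, outcome_sampleVec] at hmain
  convert hmain using 3 with n ω
  unfold muHat
  congr 1
  exact Finset.sum_congr rfl fun i hi => by simp only [(Finset.mem_filter.1 hi).2]

lemma tendstoInMeasure_sigmaSqHat [IsProbabilityMeasure P] (hiid : IsIIDSample P Y X)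
    (hh : Measurable h) (hσ : IsSortingRule σ)
    (hD : ∀ n, AssignedHalf P Y X n
      (fun x => pairStratification (σ n fun i => h (x i))) (D n))
    (hmom : ∀ d, MemLp (Y d 0) 2 P) (a : Fin 2) :
    TendstoInMeasure P
      (fun n ω => sigmaSqHat n (fun i => Y (D n ω i) i ω) (D n ω) a) atTop
      (fun _ => variance (Y a 0) P) := by
  have := hiid.isProbabilityMeasure_unitLaw
  have hm := measurable_outcome (𝒳 := 𝒳) a
  have hi : Integrable (fun x => outcome x a ^ 2) (unitLaw P Y X) :=
    (hiid.memLp_unitLaw hm (by simpa only [outcome_unit] using hmom a)).integrable_sq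
  have hsq := tendstoInMeasure_armMean hiid hh hσ hD (hm.pow_const 2) hi a
  rw [← hiid.integral_comp_unit (hm.pow_const 2) 0] at hsq
  simp only [outcome_unit, outcome_sampleVec] at hsq
  have hone := tendstoInMeasure_armMean hiid hh hσ hD (V := fun _ => 1) measurable_const
    (integrable_const _) a
  have hmu := tendstoInMeasure_muHat hiid hh hσ hD hmom a
  have hmm := tendstoInMeasure_const_mul hmu hmu
  have hall := tendstoInMeasure_const_add hsq (tendstoInMeasure_const_add
    (tendstoInMeasure_const_smul (-2) hmm) (tendstoInMeasure_const_mul hmm hone))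
  have hvar : variance (Y a 0) P = ∫ ω, Y a 0 ω ^ 2 ∂P
      + (-2 * ((∫ ω, Y a 0 ω ∂P) * ∫ ω, Y a 0 ω ∂P)
        + (∫ ω, Y a 0 ω ∂P) * (∫ ω, Y a 0 ω ∂P) * ∫ _, (1 : ℝ) ∂(unitLaw P Y X)) := by
    rw [variance_eq_sub (hmom a)]
    simp only [Pi.pow_apply, integral_const, probReal_univ, smul_eq_mul]
    ring
  rw [hvar]
  convert hall using 3 with n ω
  rw [sigmaSqHat_eq]
  congr 2
  exact Finset.sum_congr rfl fun i hi => by simp only [(Finset.mem_filter.1 hi).2]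

/-- The difference between an outcome and the average of the two conditional means given the score
is centered given the score. -/
lemma setIntegral_outcome_sub_eq_zero [IsProbabilityMeasure P] (hiid : IsIIDSample P Y X)
    (hh : Measurable h) (hmom : ∀ d, MemLp (Y d 0) 2 P) {φ : Fin 2 → ℝ → ℝ}
    (hφm : ∀ d, Measurable (φ d)) (hφi : ∀ d, Integrable (fun ω => φ d (h (X 0 ω))) P)
    (hφ : ∀ d, P[Y d 0 | sigmaH X h] =ᵐ[P] fun ω => φ d (h (X 0 ω))) {B : Set ℝ}
    (hB : MeasurableSet B) :
    ∫ x in (fun x : ℝ × ℝ × 𝒳 => h x.2.2) ⁻¹' B,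
      ((outcome x 0 - 1 / 2 * (φ 1 (h x.2.2) + φ 0 (h x.2.2)))
        + (outcome x 1 - 1 / 2 * (φ 1 (h x.2.2) + φ 0 (h x.2.2)))) ∂(unitLaw P Y X) = 0 := by
  have hX : Measurable fun ω => h (X 0 ω) := hh.comp (hiid.measurable_covariate 0)
  have hζ : Measurable fun x : ℝ × ℝ × 𝒳 => h x.2.2 := by fun_prop
  have hmζ : ∀ d, Measurable fun x : ℝ × ℝ × 𝒳 => φ d (h x.2.2) := fun d => (hφm d).comp hζ
  have hmeas : Measurable fun x : ℝ × ℝ × 𝒳 =>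
      ((outcome x 0 - 1 / 2 * (φ 1 (h x.2.2) + φ 0 (h x.2.2)))
        + (outcome x 1 - 1 / 2 * (φ 1 (h x.2.2) + φ 0 (h x.2.2)))) :=
    ((measurable_outcome 0).sub (((hmζ 1).add (hmζ 0)).const_mul _)).add
      ((measurable_outcome 1).sub (((hmζ 1).add (hmζ 0)).const_mul _))
  have hd : ∀ d, ∫ ω in (fun ω => h (X 0 ω)) ⁻¹' B, (Y d 0 ω - φ d (h (X 0 ω))) ∂P = 0 := by
    intro d
    rw [integral_sub ((hmom d).integrable one_le_two).integrableOn (hφi d).integrableOn,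
      sub_eq_zero, ← setIntegral_condExp (m := sigmaH X h) hX.comap_le
        ((hmom d).integrable one_le_two) ⟨B, hB, rfl⟩]
    refine setIntegral_congr_ae (hX hB) ?_
    filter_upwards [hφ d] with ω hω _ using hω
  have hYφ : ∀ d, Integrable (fun ω => Y d 0 ω - φ d (h (X 0 ω))) P :=
    fun d => ((hmom d).integrable one_le_two).sub (hφi d)
  unfold unitLaw
  rw [setIntegral_map (hζ hB) hmeas.aestronglyMeasurable (hiid.measurable_unit 0).aemeasurable]
  simp only [outcome_unit]
  calc _ = ∫ ω in (fun ω => h (X 0 ω)) ⁻¹' B,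
        ((Y 0 0 ω - φ 0 (h (X 0 ω))) + (Y 1 0 ω - φ 1 (h (X 0 ω)))) ∂P := by
        refine setIntegral_congr_fun (hX hB) fun ω _ => ?_
        ring
    _ = 0 := by
        rw [integral_add (hYφ 0).integrableOn (hYφ 1).integrableOn, hd 0, hd 1, add_zero]

/-- The "pairs of pairs" statistic converges to the second moment of the conditional mean of the
sum of the potential outcomes given the score. -/
lemma tendstoInMeasure_rhoHat [IsProbabilityMeasure P] (hiid : IsIIDSample P Y X)
    (hh : Measurable h) (hσ : IsSortingRule σ)
    (hD : ∀ n, AssignedHalf P Y X n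
      (fun x => pairStratification (σ n fun i => h (x i))) (D n))
    (hmom : ∀ d, MemLp (Y d 0) 2 P) (hh2 : MemLp (fun ω => h (X 0 ω)) 2 P)
    {φ : Fin 2 → ℝ → ℝ} (hφL : ∀ d, ∃ K, LipschitzWith K (φ d))
    (hφ : ∀ d, P[Y d 0 | sigmaH X h] =ᵐ[P] fun ω => φ d (h (X 0 ω))) :
    TendstoInMeasure P
      (fun n ω => rhoHat n (sortPerm σ h X n ω) (fun i => Y (D n ω i) i ω)) atTop
      (fun _ => ∫ ω, (φ 1 (h (X 0 ω)) + φ 0 (h (X 0 ω))) ^ 2 ∂P) := by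
  have := hiid.isProbabilityMeasure_unitLaw
  choose K hK using hφL
  set ψ : ℝ → ℝ := fun z => φ 1 z + φ 0 z with hψ
  have hψL : LipschitzWith (K 1 + K 0) ψ := (hK 1).add (hK 0)
  have hζ : Measurable fun x : ℝ × ℝ × 𝒳 => h x.2.2 := by fun_prop
  have hζ2 : MemLp (fun x : ℝ × ℝ × 𝒳 => h x.2.2) 2 (unitLaw P Y X) := hiid.memLp_unitLaw hζ hh2
  have hψ2 : MemLp (fun x : ℝ × ℝ × 𝒳 => ψ (h x.2.2)) 2 (unitLaw P Y X) := hψL.memLp_comp hζ2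
  have hψm : Measurable fun x : ℝ × ℝ × 𝒳 => ψ (h x.2.2) := hψL.continuous.measurable.comp hζ
  set m : ℝ × ℝ × 𝒳 → Fin 2 → ℝ := fun x _ => 1 / 2 * ψ (h x.2.2) with hm
  set r : ℝ × ℝ × 𝒳 → Fin 2 → ℝ := fun x a => outcome x a - m x a with hr
  have hmm : ∀ a, Measurable fun x => m x a := fun a => hψm.const_mul _
  have hm2 : ∀ a, MemLp (fun x => m x a) 2 (unitLaw P Y X) := fun a => hψ2.const_mul _
  have hf2 : ∀ a, MemLp (fun x : ℝ × ℝ × 𝒳 => outcome x a) 2 (unitLaw P Y X) := fun a =>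
    hiid.memLp_unitLaw (measurable_outcome a) (by simpa only [outcome_unit] using hmom a)
  have hrm : ∀ a, Measurable fun x => r x a := fun a => (measurable_outcome a).sub (hmm a)
  have hr2 : ∀ a, MemLp (fun x => r x a) 2 (unitLaw P Y X) := fun a => (hf2 a).sub (hm2 a)
  have hr0 : ∀ B, MeasurableSet B →
      ∫ x in (fun x : ℝ × ℝ × 𝒳 => h x.2.2) ⁻¹' B, (r x 0 + r x 1) ∂(unitLaw P Y X) = 0 :=
    fun B hB => setIntegral_outcome_sub_eq_zero hiid hh hmom
      (fun d => (hK d).continuous.measurable)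
      (fun d => ((hK d).memLp_comp hh2).integrable one_le_two) hφ hB
  have hcross : ∀ p q (hp : p < 4) (hq : q < 4), p / 2 ≠ q / 2 →
      TendstoInMeasure P (fun (n : ℕ) ω => (1 / n : ℝ) * ∑ j : Fin (n / 2),
        (Y (D n ω (sortPerm σ h X n ω ⟨4 * j + p, by omega⟩))
            (sortPerm σ h X n ω ⟨4 * j + p, by omega⟩) ω
          * Y (D n ω (sortPerm σ h X n ω ⟨4 * j + q, by omega⟩))
            (sortPerm σ h X n ω ⟨4 * j + q, by omega⟩) ω
          - 1 / 2 * ψ (h (X (sortPerm σ h X n ω ⟨4 * j + p, by omega⟩) ω))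
            * (1 / 2 * ψ (h (X (sortPerm σ h X n ω ⟨4 * j + q, by omega⟩) ω))))) atTop
        (fun _ => 0) := by
    intro p q hp hq hpq
    have h1 := tendstoInMeasure_crossMean hiid hh hσ hD hrm hr2 hr0 measurable_outcome hf2
      (k := fun n j => ⟨4 * j + p, by omega⟩) (l := fun n j => ⟨4 * j + q, by omega⟩)
      (fun n j => by simp only; omega) (fun n j => by simp only; omega)
      (fun n j => by simp only; omega)
    have h2 := tendstoInMeasure_crossMean hiid hh hσ hD hrm hr2 hr0 hmm hm2
      (k := fun n j => ⟨4 * j + q, by omega⟩) (l := fun n j => ⟨4 * j + p, by omega⟩)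
      (fun n j => by simp only; omega) (fun n j => by simp only; omega)
      (fun n j => by simp only; omega)
    have h3 := tendstoInMeasure_const_add h1 h2
    rw [add_zero] at h3
    convert h3 using 3 with n ω
    rw [← mul_add, ← Finset.sum_add_distrib]
    congr 1
    refine Finset.sum_congr rfl fun j _ => ?_
    simp only [hr, hm, outcome_sampleVec]
    simp only [sampleVec]
    ring
  have hpairs := tendstoInMeasure_pairProducts hiid hh hσ hζ2 hψL hψ2
  rw [← hiid.integral_comp_unit (hψm.pow_const 2) 0] at hpairs
  have hall := tendstoInMeasure_const_add (tendstoInMeasure_const_smul 2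
    (tendstoInMeasure_const_add
      (tendstoInMeasure_const_add (hcross 0 2 (by omega) (by omega) (by omega))
        (hcross 0 3 (by omega) (by omega) (by omega)))
      (tendstoInMeasure_const_add (hcross 1 2 (by omega) (by omega) (by omega))
        (hcross 1 3 (by omega) (by omega) (by omega))))) hpairs
  simp only [add_zero, mul_zero, zero_add] at hall
  convert hall using 3 with n ω
  unfold rhoHat
  simp only [Finset.mul_sum, mul_add, ← Finset.sum_add_distrib]
  refine Finset.sum_congr rfl fun j _ => ?_
  simp only [hψ]
  ring

end Estimator

theorem theorem4 {Ω 𝒳 : Type*} [MeasurableSpace Ω] [MeasurableSpace 𝒳]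
    (P : Measure Ω) [IsProbabilityMeasure P]
    (Y : Fin 2 → ℕ → Ω → ℝ) (X : ℕ → Ω → 𝒳)
    (D : ∀ n : ℕ, Ω → Fin (2 * n) → Fin 2)
    (h : 𝒳 → ℝ)
    (σ : ∀ n : ℕ, (Fin (2 * n) → ℝ) → Equiv.Perm (Fin (2 * n)))
    (hiid : IsIIDSample P Y X)
    (hσ : IsSortingRule σ)
    (hD : ∀ n, AssignedHalf P Y X n
      (fun x => pairStratification (σ n fun i => h (x i))) (D n))
    (hmom : ∀ d, MemLp (Y d 0) 2 P)
    (hh : MemH P Y X h) :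
    TendstoInMeasure P
      (fun n ω => varHat n (σ n fun i => h (X i ω))
        (fun i => Y (D n ω i) i ω) (D n ω))
      atTop (fun _ => limitVar P Y X h) := by
  have hφex : ∀ d, ∃ φ : ℝ → ℝ, (∃ K, LipschitzWith K φ) ∧
      P[Y d 0 | sigmaH X h] =ᵐ[P] fun ω => φ (h (X 0 ω)) := by
    intro d
    simpa only [pow_one] using hh.lipschitz d 1 (by simp)
  choose φ hφL hφ using hφex
  have hrho := tendstoInMeasure_rhoHat hiid hh.measurable hσ hD hmom hh.sq_integrable hφL hφ
  have hmu := tendstoInMeasure_muHat hiid hh.measurable hσ hD hmom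
  have hsig := tendstoInMeasure_sigmaSqHat hiid hh.measurable hσ hD hmom
  have hmusum := tendstoInMeasure_const_add (hmu 1) (hmu 0)
  have hall := tendstoInMeasure_const_add
    (tendstoInMeasure_const_add (tendstoInMeasure_const_add (hsig 1) (hsig 0))
      (tendstoInMeasure_const_smul (-(1 / 2)) hrho))
    (tendstoInMeasure_const_smul (1 / 2) (tendstoInMeasure_const_mul hmusum hmusum))
  have hX : Measurable fun ω => h (X 0 ω) := hh.measurable.comp (hiid.measurable_covariate 0)
  have hYi : ∀ d, Integrable (Y d 0) P := fun d => (hmom d).integrable one_le_two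
  have hφ2 : ∀ d, MemLp (fun ω => φ d (h (X 0 ω))) 2 P := fun d =>
    (hφL d).choose_spec.memLp_comp hh.sq_integrable
  have hφint : ∀ d, ∫ ω, φ d (h (X 0 ω)) ∂P = ∫ ω, Y d 0 ω ∂P := by
    intro d
    rw [← integral_congr_ae (hφ d), integral_condExp hX.comap_le]
  set ψ : Ω → ℝ := fun ω => φ 1 (h (X 0 ω)) + φ 0 (h (X 0 ω)) with hψ
  have hψ2 : MemLp ψ 2 P := (hφ2 1).add (hφ2 0)
  have hψint : ∫ ω, ψ ω ∂P = ∫ ω, Y 1 0 ω ∂P + ∫ ω, Y 0 0 ω ∂P := by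
    rw [hψ, integral_add ((hφ2 1).integrable one_le_two) ((hφ2 0).integrable one_le_two),
      hφint, hφint]
  have hcond : P[fun ω' => Y 1 0 ω' + Y 0 0 ω' | sigmaH X h] =ᵐ[P] ψ := by
    filter_upwards [condExp_add (hYi 1) (hYi 0) (sigmaH X h), hφ 1, hφ 0] with ω h1 h2 h3
    exact h1.trans (congrArg₂ (· + ·) h2 h3)
  have hlimit : limitVar P Y X h = variance (Y 1 0) P + variance (Y 0 0) P
      + -(1 / 2) * ∫ ω, (φ 1 (h (X 0 ω)) + φ 0 (h (X 0 ω))) ^ 2 ∂P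
      + 1 / 2 * ((∫ ω, Y 1 0 ω ∂P + ∫ ω, Y 0 0 ω ∂P) * (∫ ω, Y 1 0 ω ∂P + ∫ ω, Y 0 0 ω ∂P)) := by
    have hsq : ∫ ω, ((P[fun ω' => Y 1 0 ω' + Y 0 0 ω' | sigmaH X h]) ω
        - ∫ ω', (Y 1 0 ω' + Y 0 0 ω') ∂P) ^ 2 ∂P = ∫ ω, ψ ω ^ 2 ∂P - (∫ ω, ψ ω ∂P) ^ 2 := by
      rw [integral_add (hYi 1) (hYi 0), ← hψint]
      have hvar := variance_eq_sub hψ2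
      rw [variance_eq_integral hψ2.aestronglyMeasurable.aemeasurable] at hvar
      refine Eq.trans (integral_congr_ae ?_) hvar
      filter_upwards [hcond] with ω hω
      rw [hω]
    unfold limitVar
    rw [hsq, hψint]
    ring
  rw [hlimit]
  convert hall using 3 with n ω
  simp only [varHat, sortPerm]
  ring
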